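/- Let $a\in\mathbb{N}^{+}$, let $d$ be a real number with $ad\in\mathbb{N}=\{0,1,2,\dots\}$, and let $c>0$ be real. The generalized Bessel triangle $[\mathcal{T}_{n,k}]_{n,k\ge 0}$ is the lower-triangular array of polynomials in $b,\lambda$ given by $\mathcal{T}_{0,0}=1$, $\mathcal{T}_{0,k}=0$ for $k\ge1$, and, for $n\ge 1$ and $k\ge 0$ (with $\mathcal{T}_{n-1,-1}=0$), $$\mathcal{T}_{n,k}=c\,\mathcal{T}_{n-1,k-1}+\left[ab(n-1)-bk+abd+c\lambda\right]\mathcal{T}_{n-1,k}-b\lambda(k+1)\mathcal{T}_{n-1,k+1}.$$ Let $\mathcal{T}_n(q)=\sum_{k\ge0}\mathcal{T}_{n,k}q^k$. Terminology. Let $\mathbf{x}$ be a finite set of indeterminates. An infinite matrix over $\mathbb{R}[\mathbf{x}]$ is $\mathbf{x}$-TP if all its minors are polynomials with nonnegative coefficients. A sequence $(\alpha_n)_{n\ge0}$ in $\mathbb{R}[\mathbf{x}]$ is $\mathbf{x}$-SM if its Hankel matrix $[\alpha_{i+j}]_{i,j\ge0}$ is $\mathbf{x}$-TP; it is $3$-$\mathbf{x}$-log-convex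 if for every $0\le m\le3$ all terms of $\mathcal{L}^m[\alpha]$ (defined at the indices $i\ge m$) have nonnegative coefficients, where $\mathcal{L}[\alpha_i]=\alpha_{i-1}\alpha_{i+1}-\alpha_i^2$. A real sequence $(\alpha_n)_{n\ge0}$ is a Stieltjes moment (SM) sequence if $\alpha_n=\int_0^\infty x^n\,d\mu(x)$ for all $n\geq 0$, for some nonnegative measure $\mu$ on $[0,\infty)$ (with all these integrals finite). For $a=2$, $b=c=1$, $\lambda=d=0$, the triangle consists of the signless Bessel numbers of the first kind $b_{n,k}$, defined by $b_{0,0}=1$, $b_{n,k}=0$ for $k>n$, and $y_{n-1}(q)=\sum_{k=0}^{n}b_{n,k}q^{n-k}$ for $n\ge1$, where $y_n(q)=\sum_{k=0}^n\frac{(n+k)!}{(n-k)!\,k!}\left(\frac q2\right)^k$. In general: (i) For all $n,k\ge0$ and all real $b,\lambda$, $$\mathcal{T}_{n,k}=\frac{a^n}{k!}\sum_{j\ge0}\sum_{i=0}^{k+j}\frac{(-1)^{n-i}b^{n-k-j}c^{k+j}\lambda^j}{j!}\binom{k+j}{i}\left(\frac{i-ad}{a}\right)_n,$$ where $(x)_n=x(x-1)\cdots(x-n+1)$.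 (For $b=0$ we put $0^0=1$ and read negative powers of $b$ as $0$.) (ii) The matrix $[\mathcal{T}_{n,k}]_{n,k\ge0}$ is $(b,\lambda)$-TP. (iii) If $0\le ad\le a-1$, then $(\mathcal{T}_n(q))_{n\ge0}$ is $(b,\lambda,q)$-SM and $3$-$(b,\lambda,q)$-log-convex. In particular, $(\mathcal{T}_{n,0})_{n\ge0}$ is $(b,\lambda)$-SM and $3$-$(b,\lambda)$-log-convex. (iv) For every real $b>0$, the sequence $(f_n)_{n\ge1}$ defined, for $t$ near $0$, by $\sum_{n\ge1}f_n\frac{t^n}{n!}=\frac cb\left[1-(1-abt)^{1/a}\right]$ is SM, that is, $(f_{n+1})_{n\ge0}$ is an SM sequence. (v) If $0\le ad\le a-1$ and $b,\lambda\ge0$ are real, then the convolution $z_n=\sum_{k=0}^n\mathcal{T}_{n,k}x_ky_{n-k}$ preserves the Stieltjes moment property: whenever $(x_n)_{n\ge0}$ and $(y_n)_{n\ge0}$ are SM sequences, so is $(z_n)_{n\ge0}$. -/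

import Mathlib

open MeasureTheory

/-- The generalized Bessel triangle `T n k` with parameters `a`, `d`, `c` and with `b`, `lam` in an
arbitrary commutative `ℝ`-algebra `R` (so that `b`, `lam` may be real numbers or indeterminates):
`T (n+1) k = c T n (k-1) + (a b n - b k + a b d + c lam) T n k - b lam (k+1) T n (k+1)`
with `T n (-1) = 0`, `T 0 0 = 1` and `T 0 k = 0` for `0 < k`. -/
noncomputable def genBessel {R : Type*} [CommRing R] [Algebra ℝ R]
    (a : ℕ) (d c : ℝ) (b lam : R) : ℕ → ℕ → R
  | 0, 0 => 1
  | 0, _ + 1 => 0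
  | n + 1, 0 =>
      (((a : ℝ) * n + a * d) • b + c • lam) * genBessel a d c b lam n 0
        - b * lam * genBessel a d c b lam n 1
  | n + 1, k + 1 =>
      c • genBessel a d c b lam n k
        + (((a : ℝ) * n - (k + 1) + a * d) • b + c • lam) * genBessel a d c b lam n (k + 1)
        - (k + 2) * (b * lam) * genBessel a d c b lam n (k + 2)

/-- The triangle is lower triangular, so sums over all `k` of its `n`-th row reduce to `k ≤ n`. -/
theorem genBessel_eq_zero_of_lt {R : Type*} [CommRing R] [Algebra ℝ R]
    (a : ℕ) (d c : ℝ) (b lam : R) (n : ℕ) :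
    ∀ k : ℕ, n < k → genBessel a d c b lam n k = 0 := by
  induction n with
  | zero =>
    intro k hk
    cases k with
    | zero => omega
    | succ k => simp [genBessel]
  | succ n ih =>
    intro k hk
    cases k with
    | zero => omega
    | succ k =>
      simp [genBessel, ih k (by omega), ih (k + 1) (by omega), ih (k + 2) (by omega)]

/-- The row polynomial `T_n(q) = ∑_k T n k q^k`, with `q` in the same ring as `b`, `lam`. -/
noncomputable def genBesselRow {R : Type*} [CommRing R] [Algebra ℝ R]
    (a : ℕ) (d c : ℝ) (b lam q : R) (n : ℕ) : R :=
  ∑ k ∈ Finset.range (n + 1), genBessel a d c b lam n k * q ^ k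

/-- A real polynomial all of whose coefficients are nonnegative. -/
def NonnegCoeffs {σ : Type*} (P : MvPolynomial σ ℝ) : Prop :=
  ∀ m : σ →₀ ℕ, 0 ≤ MvPolynomial.coeff m P

/-- Coefficientwise total positivity of an infinite matrix of polynomials: every minor
is a polynomial with nonnegative coefficients. -/
def CoeffTP {σ : Type*} (M : ℕ → ℕ → MvPolynomial σ ℝ) : Prop :=
  ∀ (r : ℕ) (row col : Fin r → ℕ), StrictMono row → StrictMono col →
    NonnegCoeffs (Matrix.det (Matrix.of fun i j => M (row i) (col j)))

/-- Coefficientwise Stieltjes moment property of a sequence of polynomials: its infinite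
Hankel matrix is coefficientwise totally positive. -/
def CoeffSM {σ : Type*} (α : ℕ → MvPolynomial σ ℝ) : Prop :=
  CoeffTP fun i j => α (i + j)

/-- The log-convexity operator `α_{i-1} α_{i+1} - α_i ^ 2` (`i ≥ 1`), reindexed to start at `0`. -/
def logConvexOp {R : Type*} [CommRing R] (α : ℕ → R) : ℕ → R :=
  fun n => α n * α (n + 2) - α (n + 1) ^ 2

/-- Coefficientwise `k`-log-convexity: the sequence and its first `k` iterates under the
log-convexity operator have nonnegative coefficients. -/
def CoeffLogConvex {σ : Type*} (k : ℕ) (α : ℕ → MvPolynomial σ ℝ) : Prop :=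
  ∀ m ≤ k, ∀ n : ℕ, NonnegCoeffs (logConvexOp^[m] α n)

/-- Stieltjes moment sequences of real numbers: `α n = ∫ x ^ n dμ` for a nonnegative measure
`μ` on `[0, ∞)`. -/
def IsStieltjesMoment (α : ℕ → ℝ) : Prop :=
  ∃ μ : Measure ℝ, μ (Set.Iio 0) = 0 ∧
    ∀ n : ℕ, Integrable (fun x : ℝ => x ^ n) μ ∧ ∫ x, x ^ n ∂μ = α n

/-- The convolution `z n = ∑_{k ≤ n} A n k * x k * y (n - k)` preserves the Stieltjes moment
property. -/
def ConvolutionPreservesSM (A : ℕ → ℕ → ℝ) : Prop :=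
  ∀ x y : ℕ → ℝ, IsStieltjesMoment x → IsStieltjesMoment y →
    IsStieltjesMoment fun n => ∑ k ∈ Finset.range (n + 1), A n k * x k * y (n - k)

/-- The Bessel polynomial `y_n(q) = ∑_{k=0}^n (n+k)! / ((n-k)! k!) (q/2)^k`. -/
noncomputable def besselPolynomial (n : ℕ) : Polynomial ℝ :=
  ∑ k ∈ Finset.range (n + 1),
    Polynomial.C (((n + k).factorial : ℝ) / ((n - k).factorial * k.factorial) / 2 ^ k) *
      Polynomial.X ^ k

/-- The signless Bessel numbers of the first kind, `y_{n-1}(q) = ∑_{k ≤ n} b_{n,k} q^{n-k}` for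
`n ≥ 1`, with `b_{0,0} = 1`, and `b_{n,k} = 0` for `k > n`. -/
noncomputable def signlessBessel : ℕ → ℕ → ℝ
  | 0, k => if k = 0 then 1 else 0
  | n + 1, k => if k ≤ n + 1 then (besselPolynomial n).coeff (n + 1 - k) else 0

/-! Everything is read off from operators on polynomials in X. Put β = b/c, let M be multiplication
by c(X + λ), E = 1 - βD and V = E⁻¹. The row polynomials satisfy T_{n+1} = (M E + (an + ad)b) T_n,
and EM = ME - b gives V^p M = M V^p + p b V^(p+1). These relations turn the n-dependent recurrence
into powers of a fixed operator: for d = 0, T_n = (M V^(a-1))^n 1; for ad = p, T_n is V^p applied to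
this; and if p ≤ a - 1, T_n = (V^p M V^(a-1-p))^n 1 (`genBesselPoly_eq_pow`).

In the monomial basis M is bidiagonal and V is a diagonal rescaling of the lower triangular matrix
(β^(n-k)), so both are totally positive, and by Cauchy–Binet so are their products. Iterating a
totally positive operator on 1 gives a totally positive coefficient array (`IsTP.iterate_coeff`) and
a totally positive Hankel matrix of constant terms (`IsTP.iterate_hankel`). The recurrence sees X
only through X + λ and D, so T_n(q) is T_{n,0} with λ replaced by λ + q; this carries the Hankel
result to row polynomials. Log-convexity up to order 3 follows from Hankel minors of size at most 4.

For real b, y ≥ 0 the numbers T_{n,0}(b, y) are shown to be Stieltjes moments in the manner of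
Bernstein's theorem. Up to constants they are the derivatives at w = 1 of the completely monotone
function w^(-d) exp(-(cy/b) w^(1/a)). Taylor expansion about 1 + r, evaluated at 1, yields
nonnegative weights on the lattice of step 1/r having these factorial moments; letting r → ∞ gives
positivity on polynomials nonnegative on [0, ∞), and Haviland's theorem gives the measure. Since ∑
T_{n,k}(b, λ) s^k t^(n-k) = T_{n,0}(tb, tλ + s), integrating over the product of two measures
settles the convolution. The generating function is the case ad = a - 1, λ = 0.

For the explicit formula, translation in λ reduces to λ = 0, where an alternating binomial sum obeys
the same recurrence. -/

/-! ### Total positivity with respect to a subsemiring -/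

/-- All minors of the infinite matrix `M` lie in the subsemiring `S`. -/
def IsTP {R : Type*} [CommRing R] (S : Subsemiring R) (M : ℕ → ℕ → R) : Prop :=
  ∀ (r : ℕ) (row col : Fin r → ℕ), StrictMono row → StrictMono col →
    Matrix.det (Matrix.of fun i j => M (row i) (col j)) ∈ S

/-! ### Block reduction of determinants and Cauchy–Binet. -/

section Det

variable {R : Type*} [CommRing R]

theorem det_eq_mul_of_row_zero {r : ℕ} (M : Matrix (Fin (r + 1)) (Fin (r + 1)) R)
    (h : ∀ j : Fin r, M 0 j.succ = 0) :
    M.det = M 0 0 * (M.submatrix Fin.succ Fin.succ).det := by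
  rw [Matrix.det_succ_row_zero, Fin.sum_univ_succ]
  simp [h, Fin.succAbove_zero]

theorem det_eq_mul_of_col_zero {r : ℕ} (M : Matrix (Fin (r + 1)) (Fin (r + 1)) R)
    (h : ∀ i : Fin r, M i.succ 0 = 0) :
    M.det = M 0 0 * (M.submatrix Fin.succ Fin.succ).det := by
  rw [← Matrix.det_transpose, det_eq_mul_of_row_zero _ (by simpa using h),
    ← Matrix.det_transpose (M.submatrix _ _)]
  rfl

/-- The contribution of one fixed r-element index set to the Cauchy–Binet sum. -/
theorem sum_perm_det_mul {r : ℕ} {K : Type*} (A : Fin r → K → R) (B : K → Fin r → R)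
    (g : Fin r → K) :
    ∑ σ : Equiv.Perm (Fin r), (∏ i, A i (g (σ i))) *
        Matrix.det (Matrix.of fun i j => B (g (σ i)) j) =
      Matrix.det (Matrix.of fun i j => A i (g j)) * Matrix.det (Matrix.of fun i j => B (g i) j) := by
  rw [← Matrix.det_transpose (Matrix.of fun i j => A i (g j)), Matrix.det_apply', Finset.sum_mul]
  refine Finset.sum_congr rfl fun σ _ => ?_
  have := Matrix.det_permute σ (Matrix.of fun i j => B (g i) j)
  rw [show (Matrix.of fun i j => B (g (σ i)) j) =
    (Matrix.of fun i j => B (g i) j).submatrix σ id from rfl, this]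
  simp only [Matrix.transpose_apply, Matrix.of_apply]
  ring

theorem det_sum_mul {r K : ℕ} (A : Fin r → Fin K → R) (B : Fin K → Fin r → R) :
    Matrix.det (Matrix.of fun i j => ∑ k, A i k * B k j) =
      ∑ f : Fin r → Fin K, (∏ i, A i (f i)) * Matrix.det (Matrix.of fun i j => B (f i) j) := by
  have h := (Matrix.detRowAlternating (R := R) (n := Fin r)).toMultilinearMap.map_sum
    (fun i (k : Fin K) => A i k • B k)
  have e : (fun i => ∑ k, A i k • B k) = (Matrix.of fun i j => ∑ k, A i k * B k j) := by
    ext i j; simp [Finset.sum_apply]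
  rw [e] at h
  refine h.trans (Finset.sum_congr rfl fun f _ => ?_)
  exact MultilinearMap.map_smul_univ _ _ _

/-- The Cauchy–Binet formula, as closure of nonnegativity of maximal minors. -/
theorem det_sum_mul_mem (S : Subsemiring R) {r K : ℕ} (A : Fin r → Fin K → R)
    (B : Fin K → Fin r → R)
    (hA : ∀ g : Fin r → Fin K, StrictMono g → Matrix.det (Matrix.of fun i j => A i (g j)) ∈ S)
    (hB : ∀ g : Fin r → Fin K, StrictMono g → Matrix.det (Matrix.of fun i j => B (g i) j) ∈ S) :
    Matrix.det (Matrix.of fun i j => ∑ k, A i k * B k j) ∈ S := by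
  classical
  -- Group the index functions by image. An image of size r comes exactly from the increasing
  -- enumeration composed with permutations; a smaller image forces two equal rows.
  rw [det_sum_mul, ← Finset.sum_fiberwise_of_maps_to (t := Finset.univ)
    (g := fun f : Fin r → Fin K => Finset.univ.image f) (fun _ _ => Finset.mem_univ _)]
  refine S.sum_mem fun s _ => ?_
  by_cases hs : s.card = r
  · let g := s.orderEmbOfFin hs
    have hg : StrictMono g := g.strictMono
    have key : ∑ f with Finset.univ.image f = s, (∏ i, A i (f i)) *
          Matrix.det (Matrix.of fun i j => B (f i) j) =
        ∑ σ : Equiv.Perm (Fin r), (∏ i, A i (g (σ i))) *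
          Matrix.det (Matrix.of fun i j => B (g (σ i)) j) := by
      symm
      refine Finset.sum_bij (fun σ _ => fun i => g (σ i)) ?_ ?_ ?_ ?_
      · intro σ _
        simp only [Finset.mem_filter, Finset.mem_univ, true_and]
        ext x
        have : x ∈ s ↔ x ∈ Set.range g := by
          rw [Finset.range_orderEmbOfFin]; simp
        rw [this]
        simp only [Finset.mem_image, Finset.mem_univ, true_and, Set.mem_range]
        exact ⟨fun ⟨a, h⟩ => ⟨σ a, h⟩, fun ⟨a, h⟩ => ⟨σ.symm a, by simpa using h⟩⟩
      · intro σ _ τ _ h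
        ext i
        exact congrArg Fin.val (g.injective (congrFun h i))
      · intro f hf
        simp only [Finset.mem_filter, Finset.mem_univ, true_and] at hf
        have hinj : Function.Injective f := by
          rw [← Set.injOn_univ, ← Finset.coe_univ, ← Finset.card_image_iff, hf, hs]
          simp
        have hmem : ∀ i, ∃ j, g j = f i := by
          intro i
          have : f i ∈ Set.range g := by
            rw [Finset.range_orderEmbOfFin, ← hf]; simp
          exact this
        choose p hp using hmem
        have hpi : Function.Injective p := fun i j h => hinj (by rw [← hp, ← hp, h])
        exact ⟨Equiv.ofBijective p (Finite.injective_iff_bijective.1 hpi), Finset.mem_univ _,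
          funext fun i => hp i⟩
      · intro σ _; rfl
    rw [key, sum_perm_det_mul]
    exact S.mul_mem (hA _ hg) (hB _ hg)
  · rw [Finset.sum_eq_zero]
    · exact S.zero_mem
    · intro f hf
      simp only [Finset.mem_filter, Finset.mem_univ, true_and] at hf
      have : ¬ Function.Injective f := fun h => hs (by
        rw [← hf, Finset.card_image_of_injective _ h]; simp)
      rw [Function.Injective] at this
      push Not at this
      obtain ⟨i, j, hij, hne⟩ := this
      rw [Matrix.det_zero_of_row_eq hne (by ext k; simp [hij]), mul_zero]

end Det

/-! ### Closure properties of total positivity. -/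

namespace IsTP

variable {R : Type*} [CommRing R] {S : Subsemiring R}

theorem transpose {M : ℕ → ℕ → R} (h : IsTP S M) : IsTP S fun i j => M j i := by
  intro r row col hr hc
  rw [← Matrix.det_transpose]
  exact h r col row hc hr

theorem scale {M : ℕ → ℕ → R} (h : IsTP S M) {x y : ℕ → R} (hx : ∀ i, x i ∈ S)
    (hy : ∀ i, y i ∈ S) : IsTP S fun i j => x i * (M i j * y j) := by
  intro r row col hr hc
  have : (Matrix.of fun i j => x (row i) * (M (row i) (col j) * y (col j))) =
      Matrix.diagonal (fun i => x (row i)) * ((Matrix.of fun i j => M (row i) (col j)) *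
        Matrix.diagonal (fun i => y (col i))) := by
    ext i j; simp [Matrix.mul_diagonal, Matrix.diagonal_mul]
  rw [this, Matrix.det_mul, Matrix.det_mul, Matrix.det_diagonal, Matrix.det_diagonal]
  exact S.mul_mem (S.prod_mem fun _ _ => hx _)
    (S.mul_mem (h r row col hr hc) (S.prod_mem fun _ _ => hy _))

/-- The hypothesis expresses an infinite matrix product whose entries are eventually constant
partial sums. A given minor involves finitely many entries, so one truncation serves them all and
Cauchy–Binet applies. -/
theorem mul {A B C : ℕ → ℕ → R} (hA : IsTP S A) (hB : IsTP S B)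
    (h : ∀ i j, ∃ K, ∀ K' ≥ K, C i j = ∑ k ∈ Finset.range K', A i k * B k j) : IsTP S C := by
  intro r row col hr hc
  choose N hN using h
  let K := ∑ i, ∑ j, N (row i) (col j)
  have hK : ∀ i j, N (row i) (col j) ≤ K := fun i j =>
    (Finset.single_le_sum (f := fun j => N (row i) (col j)) (fun _ _ => Nat.zero_le _)
      (Finset.mem_univ j)).trans
    (Finset.single_le_sum (f := fun i => ∑ j, N (row i) (col j)) (fun _ _ => Nat.zero_le _)
      (Finset.mem_univ i))
  have e : (Matrix.of fun i j => C (row i) (col j)) =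
      Matrix.of fun i j => ∑ k : Fin K, A (row i) k * B k (col j) := by
    ext i j
    simp only [Matrix.of_apply]
    rw [hN _ _ K (hK i j), Finset.sum_range]
  rw [e]
  exact det_sum_mul_mem S (fun i k => A (row i) k) (fun k j => B k (col j))
    (fun g hg => hA r row (fun j => g j) hr hg) (fun g hg => hB r (fun j => g j) col hg hc)

/-- Upper bidiagonal matrices with entries in `S`. -/
theorem bidiagonal {s t : ℕ → R} (hs : ∀ i, s i ∈ S) (ht : ∀ i, t i ∈ S) :
    IsTP S fun i j => if j = i then s i else if j = i + 1 then t i else 0 := by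
  intro r
  induction r with
  | zero => intro row col _ _; simp
  | succ r ih =>
    intro row col hr hc
    have hr' : ∀ i : Fin r, row 0 < row i.succ := fun i => hr (Fin.succ_pos i)
    have hc' : ∀ i : Fin r, col 0 < col i.succ := fun i => hc (Fin.succ_pos i)
    have hsub := ih (fun i => row i.succ) (fun i => col i.succ)
      (hr.comp (Fin.strictMono_succ)) (hc.comp (Fin.strictMono_succ))
    have hmem : ∀ i j, (if j = i then s i else if j = i + 1 then t i else 0) ∈ S := by
      intro i j
      split_ifs
      exacts [hs i, ht i, S.zero_mem]
    -- If the first column index is at most the first row index, the first column vanishes below its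
    -- top entry; otherwise the first row vanishes to the right of it.
    rcases le_or_gt (col 0) (row 0) with h | h
    · rw [det_eq_mul_of_col_zero]
      · exact S.mul_mem (hmem _ _) hsub
      · intro i
        have := hr' i
        simp only [Matrix.of_apply]
        rw [if_neg (by omega), if_neg (by omega)]
    · rw [det_eq_mul_of_row_zero]
      · exact S.mul_mem (hmem _ _) hsub
      · intro j
        have := hc' j
        simp only [Matrix.of_apply]
        rw [if_neg (by omega), if_neg (by omega)]

/-- The output matrix of a totally positive production matrix is totally positive. -/
theorem output {P O : ℕ → ℕ → R} (hP : IsTP S P) (h0 : ∀ k, O 0 k = if k = 0 then 1 else 0)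
    (hO : ∀ n k, ∃ K, ∀ K' ≥ K, O (n + 1) k = ∑ j ∈ Finset.range K', O n j * P j k) :
    IsTP S O := by
  -- the part of `O` with row index less than `m`, prolonged by zero
  have main : ∀ m, IsTP S fun i j => if i < m then O i j else 0 := by
    intro m
    induction m with
    | zero =>
      intro r row col _ _
      cases r with
      | zero => simp
      | succ r =>
        rw [Matrix.det_eq_zero_of_row_eq_zero 0 (by simp)]
        exact S.zero_mem
    | succ m ih =>
      -- The first m + 1 rows of `O` factor as A B, where A is the block sum of 1 with the first m
      -- rows of `O`, and B is `P` with the unit row e₀ placed on top.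
      let A : ℕ → ℕ → R := fun i k => match i, k with
        | 0, 0 => 1
        | 0, _ + 1 => 0
        | _ + 1, 0 => 0
        | i + 1, k + 1 => if i < m then O i k else 0
      let B : ℕ → ℕ → R := fun i k => match i, k with
        | 0, 0 => 1
        | 0, _ + 1 => 0
        | i + 1, k => P i k
      have hA : IsTP S A := by
        intro r row col hr hc
        cases r with
        | zero => simp
        | succ r =>
          have hr' : ∀ i : Fin r, row 0 < row i.succ := fun i => hr (Fin.succ_pos i)
          have hc' : ∀ i : Fin r, col 0 < col i.succ := fun i => hc (Fin.succ_pos i)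
          have sub : ∀ {q : ℕ} (f g : Fin q → ℕ), StrictMono f → StrictMono g → (∀ i, 0 < f i) →
              (∀ i, 0 < g i) → Matrix.det (Matrix.of fun i j => A (f i) (g j)) ∈ S := by
            intro q f g hf hg hf0 hg0
            have := ih q (fun i => f i - 1) (fun i => g i - 1)
              (fun i j hij => by have := hf hij; have := hf0 i; dsimp only; omega)
              (fun i j hij => by have := hg hij; have := hg0 i; dsimp only; omega)
            convert! this using 2
            ext i j
            obtain ⟨x, hx⟩ := Nat.exists_eq_add_of_lt (hf0 i)
            obtain ⟨y, hy⟩ := Nat.exists_eq_add_of_lt (hg0 j)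
            simp [hx, hy, A]
          rcases Nat.eq_zero_or_pos (row 0) with h | h
          · rw [det_eq_mul_of_row_zero]
            · refine S.mul_mem ?_ ?_
              · simp only [Matrix.of_apply, h]
                rcases Nat.eq_zero_or_pos (col 0) with h' | h'
                · simp [h', A, S.one_mem]
                · obtain ⟨y, hy⟩ := Nat.exists_eq_add_of_lt h'
                  simp [hy, A, S.zero_mem]
              · exact sub (fun i => row i.succ) (fun i => col i.succ)
                  (hr.comp (Fin.strictMono_succ)) (hc.comp (Fin.strictMono_succ))
                  (fun i => by have := hr' i; omega) (fun i => by have := hc' i; omega)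
            · intro j
              obtain ⟨y, hy⟩ := Nat.exists_eq_add_of_lt (hc' j)
              simp [h, hy, A]
          · rcases Nat.eq_zero_or_pos (col 0) with h' | h'
            · rw [Matrix.det_eq_zero_of_column_eq_zero 0]
              · exact S.zero_mem
              · intro i
                have : 0 < row i := h.trans_le (hr.monotone (Fin.zero_le i))
                obtain ⟨y, hy⟩ := Nat.exists_eq_add_of_lt this
                simp [h', hy, A]
            · exact sub row col hr hc (fun i => h.trans_le (hr.monotone (Fin.zero_le i)))
                (fun i => h'.trans_le (hc.monotone (Fin.zero_le i)))
      have hB : IsTP S B := by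
        intro r row col hr hc
        cases r with
        | zero => simp
        | succ r =>
          have hr' : ∀ i : Fin r, row 0 < row i.succ := fun i => hr (Fin.succ_pos i)
          have hc' : ∀ i : Fin r, col 0 < col i.succ := fun i => hc (Fin.succ_pos i)
          have sub : ∀ {q : ℕ} (f g : Fin q → ℕ), StrictMono f → StrictMono g → (∀ i, 0 < f i) →
              Matrix.det (Matrix.of fun i j => B (f i) (g j)) ∈ S := by
            intro q f g hf hg hf0
            have := hP q (fun i => f i - 1) g
              (fun i j hij => by have := hf hij; have := hf0 i; dsimp only; omega) hg
            convert! this using 2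
            ext i j
            obtain ⟨x, hx⟩ := Nat.exists_eq_add_of_lt (hf0 i)
            simp [hx, B]
          rcases Nat.eq_zero_or_pos (row 0) with h | h
          · rw [det_eq_mul_of_row_zero]
            · refine S.mul_mem ?_ ?_
              · simp only [Matrix.of_apply, h]
                rcases Nat.eq_zero_or_pos (col 0) with h' | h'
                · simp [h', B, S.one_mem]
                · obtain ⟨y, hy⟩ := Nat.exists_eq_add_of_lt h'
                  simp [hy, B, S.zero_mem]
              · exact sub (fun i => row i.succ) (fun i => col i.succ)
                  (hr.comp (Fin.strictMono_succ)) (hc.comp (Fin.strictMono_succ))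
                  (fun i => by have := hr' i; omega)
            · intro j
              obtain ⟨y, hy⟩ := Nat.exists_eq_add_of_lt (hc' j)
              simp [h, hy, B]
          · exact sub row col hr hc (fun i => h.trans_le (hr.monotone (Fin.zero_le i)))
      refine mul hA hB fun i k => ?_
      rcases i with _ | i
      · refine ⟨1, fun K' hK' => ?_⟩
        obtain ⟨n, rfl⟩ := Nat.exists_eq_add_of_le' hK'
        rw [Finset.sum_range_succ']
        rcases k with _ | k <;> simp [A, B, h0]
      · by_cases hi : i < m
        · obtain ⟨K, hK⟩ := hO i k
          refine ⟨K + 1, fun K' hK' => ?_⟩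
          obtain ⟨n, rfl⟩ := Nat.exists_eq_add_of_le' (show 1 ≤ K' by omega)
          rw [Finset.sum_range_succ']
          simp only [Nat.add_lt_add_iff_right, hi, if_true, A, B, zero_mul, add_zero]
          exact hK n (by omega)
        · refine ⟨1, fun K' hK' => ?_⟩
          obtain ⟨n, rfl⟩ := Nat.exists_eq_add_of_le' hK'
          rw [Finset.sum_range_succ']
          simp [A, B, hi]
  intro r row col hr hc
  have := main (∑ i, row i + 1) r row col hr hc
  convert! this using 2
  ext i j
  have : row i ≤ ∑ i, row i :=
    Finset.single_le_sum (f := row) (fun _ _ => Nat.zero_le _) (Finset.mem_univ i)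
  simp only [Matrix.of_apply]
  rw [if_pos (Nat.lt_succ_of_le this)]

end IsTP

/-! ### Total positivity of linear operators on polynomials -/

section Operators

open Polynomial

variable {R : Type*} [CommRing R] {S : Subsemiring R}

/-- The matrix of a linear operator on polynomials in the monomial basis, with images as rows. -/
noncomputable def opMatrix (A : Module.End R R[X]) (i j : ℕ) : R := (A (X ^ i)).coeff j

theorem coeff_apply_eq_sum (A : Module.End R R[X]) (f : R[X]) (j : ℕ) {K : ℕ}
    (hK : f.natDegree + 1 ≤ K) :
    (A f).coeff j = ∑ k ∈ Finset.range K, f.coeff k * opMatrix A k j := by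
  conv_lhs => rw [f.as_sum_range' K hK]
  rw [map_sum, finsetSum_coeff]
  refine Finset.sum_congr rfl fun k _ => ?_
  rw [← C_mul_X_pow_eq_monomial, ← smul_eq_C_mul, map_smul, coeff_smul, smul_eq_mul, opMatrix]

/-- Images are stored as rows, so composition becomes matrix multiplication in the opposite order.
-/
theorem IsTP.opMatrix_mul {A B : Module.End R R[X]} (hA : IsTP S (opMatrix A))
    (hB : IsTP S (opMatrix B)) : IsTP S (opMatrix (A * B)) :=
  IsTP.mul hB hA fun i j => ⟨(B (X ^ i)).natDegree + 1, fun _ hK =>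
    coeff_apply_eq_sum A (B (X ^ i)) j hK⟩

theorem IsTP.opMatrix_one : IsTP S (opMatrix (1 : Module.End R R[X])) := by
  convert IsTP.bidiagonal (S := S) (s := fun _ => 1) (t := fun _ => 0) (fun _ => S.one_mem)
    (fun _ => S.zero_mem) using 1
  ext i j
  simp [opMatrix, coeff_X_pow]

theorem IsTP.opMatrix_pow {A : Module.End R R[X]} (hA : IsTP S (opMatrix A)) (n : ℕ) :
    IsTP S (opMatrix (A ^ n)) := by
  induction n with
  | zero => simpa using IsTP.opMatrix_one
  | succ n ih => rw [pow_succ]; exact ih.opMatrix_mul hA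

/-- Iterates of a totally positive operator on `1` form a totally positive matrix. -/
theorem IsTP.iterate_coeff {A : Module.End R R[X]} (hA : IsTP S (opMatrix A)) :
    IsTP S fun n k => ((A ^ n) 1).coeff k := by
  refine IsTP.output hA (fun k => by simp [coeff_one]) fun n k => ?_
  refine ⟨((A ^ n) 1).natDegree + 1, fun K' hK => ?_⟩
  rw [pow_succ', Module.End.mul_apply, coeff_apply_eq_sum A _ k hK]

/-- The Hankel matrix of the constant coefficients of the iterates of a totally positive
operator is totally positive. -/
theorem IsTP.iterate_hankel {A : Module.End R R[X]} (hA : IsTP S (opMatrix A)) :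
    IsTP S fun i j => ((A ^ (i + j)) 1).coeff 0 := by
  -- The constant terms of A^j X^k form the output array of the transposed matrix. Splitting A^(i+j)
  -- 1 as A^j (A^i 1) then writes the Hankel matrix as a product of two output arrays, the second
  -- transposed.
  have h2 : IsTP S fun j k => opMatrix (A ^ j) k 0 := by
    refine IsTP.output hA.transpose (fun k => by simp [opMatrix, coeff_X_pow, eq_comm]) fun n k => ?_
    refine ⟨(A (X ^ k)).natDegree + 1, fun K' hK => ?_⟩
    rw [opMatrix, pow_succ, Module.End.mul_apply, coeff_apply_eq_sum _ _ _ hK]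
    exact Finset.sum_congr rfl fun j _ => mul_comm _ _
  refine IsTP.mul hA.iterate_coeff h2.transpose fun i j => ?_
  refine ⟨((A ^ i) 1).natDegree + 1, fun K' hK => ?_⟩
  rw [add_comm i j, pow_add, Module.End.mul_apply, coeff_apply_eq_sum _ _ _ hK]

/-! ### The operators 1 - βD, its inverse, and multiplication by c(X + λ). -/

theorem end_ext_X_pow {A B : Module.End R R[X]} (h : ∀ n, A (X ^ n) = B (X ^ n)) : A = B := by
  refine (basisMonomials R).ext fun n => ?_
  simpa [coe_basisMonomials, monomial_one_right_eq_X_pow] using h n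

/-- The image of `X ^ n` under the inverse of `1 - β D`. -/
noncomputable def resolventPoly (β : R) : ℕ → R[X]
  | 0 => 1
  | n + 1 => X ^ (n + 1) + ((n + 1 : R) * β) • resolventPoly β n

/-- The operator `(1 - β D)⁻¹` on polynomials. -/
noncomputable def derivResolvent (β : R) : Module.End R R[X] :=
  (basisMonomials R).constr R (resolventPoly β)

theorem derivResolvent_X_pow (β : R) (n : ℕ) : derivResolvent β (X ^ n) = resolventPoly β n := by
  have := (basisMonomials R).constr_basis R (resolventPoly β) n
  simp only [coe_basisMonomials, monomial_one_right_eq_X_pow] at this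
  exact this

/-- The operator `1 - β D` on polynomials. -/
noncomputable def oneSubDeriv (β : R) : Module.End R R[X] := 1 - β • derivative

theorem oneSubDeriv_X_pow_succ (β : R) (n : ℕ) :
    oneSubDeriv β (X ^ (n + 1)) = X ^ (n + 1) - ((n + 1 : R) * β) • X ^ n := by
  simp only [oneSubDeriv, LinearMap.sub_apply, Module.End.one_apply, LinearMap.smul_apply,
    derivative_X_pow, smul_eq_C_mul, C_mul]
  simp
  ring

theorem oneSubDeriv_mul_derivResolvent (β : R) : oneSubDeriv β * derivResolvent β = 1 := by
  refine end_ext_X_pow fun n => ?_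
  rw [Module.End.mul_apply, derivResolvent_X_pow, Module.End.one_apply]
  induction n with
  | zero => simp [resolventPoly, oneSubDeriv]
  | succ n ih => rw [resolventPoly, map_add, map_smul, ih, oneSubDeriv_X_pow_succ]; abel

theorem derivResolvent_mul_oneSubDeriv (β : R) : derivResolvent β * oneSubDeriv β = 1 := by
  refine end_ext_X_pow fun n => ?_
  rw [Module.End.mul_apply, Module.End.one_apply]
  cases n with
  | zero =>
    have := derivResolvent_X_pow β 0
    simp only [pow_zero, resolventPoly] at this
    simp [oneSubDeriv, this]
  | succ n =>
    rw [oneSubDeriv_X_pow_succ, map_sub, map_smul, derivResolvent_X_pow, derivResolvent_X_pow, resolventPoly]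
    abel

/-- This is the output array of the bidiagonal production matrix with β in the corner, zeros on the
rest of the diagonal and ones above it. -/
theorem geometric_isTP {β : R} (hβ : β ∈ S) :
    IsTP S fun n k => if k ≤ n then β ^ (n - k) else 0 := by
  refine IsTP.output (P := fun i j => if j = i then (if i = 0 then β else 0) else
    if j = i + 1 then 1 else 0) (IsTP.bidiagonal (s := fun i => if i = 0 then β else 0)
    (t := fun _ => 1) ?_ fun _ => S.one_mem) ?_ ?_
  · intro i; split_ifs; exacts [hβ, S.zero_mem]
  · intro k; simp
  · intro n k
    refine ⟨k + 1, fun K' hK' => ?_⟩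
    cases k with
    | zero =>
      rw [Finset.sum_eq_single_of_mem 0 (by simp; omega)]
      · simp [pow_succ]
      · intro j _ hj; simp [hj.symm]
    | succ k =>
      rw [Finset.sum_eq_single_of_mem k (by simp; omega)]
      · simp
      · intro j _ hj
        rcases eq_or_ne (k + 1) j with h | h
        · subst h; simp
        · rw [if_neg h, if_neg (by omega : ¬ k + 1 = j + 1), mul_zero]

/-- Since (1 - βD)⁻¹ = ∑ β^k D^k, its matrix is the geometric one conjugated by the diagonal of
factorials. -/
theorem resolventPoly_coeff [Algebra ℝ R] (β : R) (n k : ℕ) :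
    (resolventPoly β n).coeff k = algebraMap ℝ R (n.factorial : ℝ) *
      ((if k ≤ n then β ^ (n - k) else 0) * algebraMap ℝ R ((k.factorial : ℝ)⁻¹)) := by
  induction n with
  | zero =>
    rcases Nat.eq_zero_or_pos k with rfl | h
    · simp [resolventPoly]
    · simp [resolventPoly, coeff_one, h.ne']
  | succ n ih =>
    rw [resolventPoly, coeff_add, coeff_smul, ih, coeff_X_pow, smul_eq_mul]
    have hcast : algebraMap ℝ R ((n + 1).factorial : ℝ) =
        (n + 1 : R) * algebraMap ℝ R (n.factorial : ℝ) := by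
      rw [Nat.factorial_succ]; push_cast; simp
    rcases lt_trichotomy k (n + 1) with h | h | h
    · rw [if_neg h.ne, if_pos (by omega), if_pos (by omega), hcast, Nat.succ_sub (by omega),
        pow_succ]
      ring
    · subst h
      rw [if_pos rfl, if_neg (by omega), if_pos le_rfl]
      simp only [Nat.sub_self, pow_zero, one_mul, zero_mul, mul_zero, add_zero]
      rw [← map_mul, mul_inv_cancel₀ (by positivity), map_one]
    · rw [if_neg h.ne', if_neg (by omega), if_neg (by omega)]
      simp

theorem IsTP.derivResolvent [Algebra ℝ R] (hS : ∀ x : ℝ, 0 ≤ x → algebraMap ℝ R x ∈ S) {β : R}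
    (hβ : β ∈ S) : IsTP S (opMatrix (_root_.derivResolvent β)) := by
  have := (geometric_isTP hβ).scale (x := fun n => algebraMap ℝ R (n.factorial : ℝ))
    (y := fun k => algebraMap ℝ R ((k.factorial : ℝ)⁻¹)) (fun _ => hS _ (by positivity))
    (fun _ => hS _ (by positivity))
  convert! this using 1
  ext n k
  rw [opMatrix, derivResolvent_X_pow, resolventPoly_coeff]

/-- Multiplication by `c (X + lam)`. -/
noncomputable def mulAffine (c lam : R) : Module.End R R[X] :=
  LinearMap.mulLeft R (C c * (X + C lam))

theorem IsTP.mulAffine {c lam : R} (hc : c ∈ S) (hlam : lam ∈ S) :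
    IsTP S (opMatrix (mulAffine c lam)) := by
  convert! IsTP.bidiagonal (S := S) (s := fun _ => c * lam) (t := fun _ => c)
    (fun _ => S.mul_mem hc hlam) (fun _ => hc) using 1
  ext i j
  simp only [opMatrix, _root_.mulAffine, LinearMap.mulLeft_apply]
  rw [mul_assoc, add_mul, ← pow_succ', coeff_C_mul, coeff_add, coeff_C_mul, coeff_X_pow,
    coeff_X_pow]
  rcases eq_or_ne j i with rfl | h
  · simp
  · simp [h]

theorem oneSubDeriv_mul_mulAffine (β c lam : R) :
    oneSubDeriv β * mulAffine c lam = mulAffine c lam * oneSubDeriv β - (c * β) • 1 := by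
  refine LinearMap.ext fun f => ?_
  simp only [Module.End.mul_apply, LinearMap.sub_apply, LinearMap.smul_apply, Module.End.one_apply,
    oneSubDeriv, mulAffine, LinearMap.mulLeft_apply, derivative_mul, derivative_C,
    smul_eq_C_mul, C_mul]
  simp
  ring

end Operators

/-! ### Commutation relations -/

section Commutation

variable {R A : Type*} [CommRing R] [Ring A] [Algebra R A] {M V E : A} {b : R}

/-- Multiplying EM = ME - b by V on both sides gives VM = MV + bV²; induction does the rest. -/
theorem pow_mul_of_comm_rel (hVE : V * E = 1) (hEV : E * V = 1) (hEM : E * M = M * E - b • 1)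
    (n : ℕ) : V ^ n * M = M * V ^ n + (n : R) • b • V ^ (n + 1) := by
  have h1 : V * M = M * V + b • V ^ 2 := by
    have : V * (E * M) * V = V * (M * E - b • 1) * V := by rw [hEM]
    have e1 : V * (E * M) * V = M * V := by rw [← mul_assoc, hVE, one_mul]
    have e2 : V * (M * E - b • 1) * V = V * M - b • V ^ 2 := by
      rw [mul_sub, sub_mul, mul_assoc V, mul_assoc M, hEV, mul_one, mul_smul_comm, mul_one,
        smul_mul_assoc, sq]
    rw [e1, e2] at this
    rw [this]; abel
  induction n with
  | zero => simp
  | succ n ih =>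
    rw [pow_succ', mul_assoc, ih, mul_add, ← mul_assoc, h1, add_mul, mul_smul_comm, mul_smul_comm,
      ← pow_succ', smul_mul_assoc, mul_assoc, ← pow_succ', ← pow_add, add_assoc]
    congr 1
    rw [show 2 + n = n + 1 + 1 by ring]
    push_cast
    module

/-- Solution of the recurrence `G (n+1) = (M E + a b n) G n` by a time-independent operator. -/
theorem smul_add_mul_pow (hVE : V * E = 1) (hEV : E * V = 1) (hEM : E * M = M * E - b • 1)
    (a n : ℕ) : (M * E + ((a + 1 : R) * n * b) • 1) * (M * V ^ a) ^ n =
      (M * V ^ a) ^ n * (M * E) := by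
  -- Moving M E leftwards past one factor M V^a adds (a + 1)b, which is exactly the increment of the
  -- recurrence from n to n + 1.
  have key : M * V ^ a * (M * E) = (M * E + ((a + 1 : R) * b) • 1) * (M * V ^ a) := by
    have hc : V ^ a * E = E * V ^ a := ((Commute.pow_left (show Commute V E from
      hVE.trans hEV.symm)) a).eq
    have h2 : V ^ (a + 1) * E = V ^ a := by rw [pow_succ, mul_assoc, hVE, mul_one]
    have e1 : M * V ^ a * (M * E) = M * (M * (V ^ a * E)) + ((a : R) * b) • (M * V ^ a) := by
      rw [mul_assoc, ← mul_assoc (V ^ a), pow_mul_of_comm_rel hVE hEV hEM, add_mul, smul_mul_assoc,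
        smul_mul_assoc, h2, mul_add, mul_assoc M (V ^ a), smul_smul, mul_smul_comm]
    have e2 : M * E * (M * V ^ a) = M * (M * (V ^ a * E)) - b • (M * V ^ a) := by
      rw [mul_assoc, ← mul_assoc E, hEM, sub_mul, mul_sub, smul_mul_assoc, one_mul, mul_smul_comm,
        mul_assoc M E, hc]
    rw [e1, add_mul, e2, smul_mul_assoc, one_mul]
    module
  induction n with
  | zero => simp
  | succ n ih =>
    generalize M * V ^ a = P at *
    rw [pow_succ', mul_assoc P, ← ih, ← mul_assoc P, mul_add, key, ← mul_assoc]
    congr 1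
    simp only [add_mul, mul_smul_comm, smul_mul_assoc, one_mul, mul_one, Nat.cast_add, Nat.cast_one]
    module

end Commutation

/-! ### Row polynomials of the generalized Bessel triangle -/

section RowPolynomial

open Polynomial

variable {R : Type*} [CommRing R]

theorem derivResolvent_one (β : R) : derivResolvent β 1 = 1 := by
  simpa [resolventPoly] using derivResolvent_X_pow β 0

theorem derivResolvent_pow_one (β : R) (n : ℕ) : (derivResolvent β ^ n) 1 = 1 := by
  induction n with
  | zero => simp
  | succ n ih => rw [pow_succ', Module.End.mul_apply, ih, derivResolvent_one]

variable [Algebra ℝ R]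

/-- The row polynomial of the triangle in a formal variable. -/
noncomputable def genBesselPoly (a : ℕ) (d c : ℝ) (b lam : R) (n : ℕ) : R[X] :=
  ∑ k ∈ Finset.range (n + 1), C (genBessel a d c b lam n k) * X ^ k

theorem genBesselPoly_coeff (a : ℕ) (d c : ℝ) (b lam : R) (n k : ℕ) :
    (genBesselPoly a d c b lam n).coeff k = genBessel a d c b lam n k := by
  rw [genBesselPoly, finsetSum_coeff]
  simp only [coeff_C_mul_X_pow]
  rw [Finset.sum_ite_eq]
  split_ifs with h
  · rfl
  · rw [genBessel_eq_zero_of_lt]; simpa using h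

theorem genBesselPoly_eval (a : ℕ) (d c : ℝ) (b lam q : R) (n : ℕ) :
    (genBesselPoly a d c b lam n).eval q = genBesselRow a d c b lam q n := by
  simp [genBesselPoly, genBesselRow, eval_finsetSum]

theorem genBesselPoly_zero (a : ℕ) (d c : ℝ) (b lam : R) : genBesselPoly a d c b lam 0 = 1 := by
  simp [genBesselPoly, genBessel]

theorem genBesselPoly_succ (a : ℕ) (d c : ℝ) (b lam : R) (n : ℕ) :
    genBesselPoly a d c b lam (n + 1) =
      (X + C lam) * (C (algebraMap ℝ R c) * genBesselPoly a d c b lam n -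
        C b * derivative (genBesselPoly a d c b lam n)) +
      C (algebraMap ℝ R (a * n + a * d) * b) * genBesselPoly a d c b lam n := by
  ext k
  rw [genBesselPoly_coeff, add_mul, coeff_add, coeff_add, coeff_C_mul, coeff_C_mul, coeff_sub,
    coeff_C_mul, coeff_C_mul, coeff_derivative, genBesselPoly_coeff]
  cases k with
  | zero =>
    rw [coeff_X_mul_zero, genBesselPoly_coeff, genBessel, Algebra.smul_def, Algebra.smul_def]
    push_cast
    ring
  | succ k =>
    rw [coeff_X_mul, coeff_sub, coeff_C_mul, coeff_C_mul, coeff_derivative, genBesselPoly_coeff,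
      genBesselPoly_coeff, genBesselPoly_coeff, genBessel, Algebra.smul_def, Algebra.smul_def,
      Algebra.smul_def]
    have : algebraMap ℝ R (a * n - (k + 1) + a * d) =
      algebraMap ℝ R (a * n + a * d) - (k + 1) := by
      rw [show (a * n - (k + 1) + a * d : ℝ) = (a * n + a * d) - ((k + 1 : ℕ) : ℝ) by
        push_cast; ring, map_sub, map_natCast]
      push_cast; rfl
    rw [this]
    push_cast
    ring

theorem genBesselPoly_succ_eq_operator (a : ℕ) (d c : ℝ) {b β : R} (lam : R)
    (hβ : algebraMap ℝ R c * β = b) (n : ℕ) :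
    genBesselPoly a d c b lam (n + 1) =
      (mulAffine (algebraMap ℝ R c) lam * oneSubDeriv β +
        (algebraMap ℝ R (a * n + a * d) * b) • 1) (genBesselPoly a d c b lam n) := by
  rw [genBesselPoly_succ]
  simp only [LinearMap.add_apply, Module.End.mul_apply, LinearMap.smul_apply, Module.End.one_apply,
    mulAffine, oneSubDeriv, LinearMap.mulLeft_apply, LinearMap.sub_apply, smul_eq_C_mul, ← hβ,
    C_mul]
  ring

theorem oneSubDeriv_mul_mulAffine' {c : ℝ} {b β : R} (lam : R) (hβ : algebraMap ℝ R c * β = b) :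
    oneSubDeriv β * mulAffine (algebraMap ℝ R c) lam =
      mulAffine (algebraMap ℝ R c) lam * oneSubDeriv β - b • 1 := by
  rw [oneSubDeriv_mul_mulAffine, hβ]

/-- The time-dependent operator slides through the powers as M E, and on the constant 1 both E and V
act trivially, so M E 1 = M V^a 1. The Bessel parameter is a + 1. -/
theorem genBesselPoly_zero_eq_pow (a : ℕ) {c : ℝ} {b β : R} (lam : R)
    (hβ : algebraMap ℝ R c * β = b) (n : ℕ) :
    genBesselPoly (a + 1) 0 c b lam n =
      ((mulAffine (algebraMap ℝ R c) lam * derivResolvent β ^ a) ^ n) 1 := by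
  induction n with
  | zero => simp [genBesselPoly_zero]
  | succ n ih =>
    have h := smul_add_mul_pow (derivResolvent_mul_oneSubDeriv β) (oneSubDeriv_mul_derivResolvent β)
      (oneSubDeriv_mul_mulAffine' lam hβ) a n
    have h' := congrArg (fun A : Module.End R R[X] => A 1) h
    simp only [Module.End.mul_apply] at h'
    rw [genBesselPoly_succ_eq_operator _ _ _ _ hβ, ih]
    have e : algebraMap ℝ R (((a + 1 : ℕ) : ℝ) * n + ((a + 1 : ℕ) : ℝ) * 0) =
        (a + 1 : R) * n := by
      push_cast; simp
    rw [e, h', pow_succ, Module.End.mul_apply, Module.End.mul_apply, derivResolvent_pow_one]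
    simp [oneSubDeriv]

/-- V^p intertwines the two recurrences: V^p M E = (M E + p b) V^p, and p b is the term contributed
by ad = p. -/
theorem genBesselPoly_eq_derivResolvent (a p : ℕ) {d c : ℝ} {b β : R} (lam : R)
    (hd : (a : ℝ) * d = p) (hβ : algebraMap ℝ R c * β = b) (n : ℕ) :
    genBesselPoly a d c b lam n = (derivResolvent β ^ p) (genBesselPoly a 0 c b lam n) := by
  induction n with
  | zero => rw [genBesselPoly_zero, genBesselPoly_zero, derivResolvent_pow_one]
  | succ n ih =>
    rw [genBesselPoly_succ_eq_operator _ _ _ _ hβ, genBesselPoly_succ_eq_operator _ _ _ _ hβ, ih,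
      ← Module.End.mul_apply, ← Module.End.mul_apply]
    congr 1
    have h := pow_mul_of_comm_rel (derivResolvent_mul_oneSubDeriv β)
      (oneSubDeriv_mul_derivResolvent β) (oneSubDeriv_mul_mulAffine' lam hβ) p
    have hVE := derivResolvent_mul_oneSubDeriv β
    have hc : derivResolvent β ^ p * oneSubDeriv β = oneSubDeriv β * derivResolvent β ^ p :=
      ((Commute.pow_left (show Commute (derivResolvent β) (oneSubDeriv β) from
        hVE.trans (oneSubDeriv_mul_derivResolvent β).symm)) p).eq
    have h2 : derivResolvent β ^ (p + 1) * oneSubDeriv β = derivResolvent β ^ p := by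
      rw [pow_succ, mul_assoc, hVE, mul_one]
    rw [mul_add, ← mul_assoc (derivResolvent β ^ p), h, add_mul _ _ (oneSubDeriv β),
      mul_assoc _ _ (oneSubDeriv β), hc, smul_mul_assoc, smul_mul_assoc, h2,
      add_mul, mul_assoc, mul_smul_comm, smul_mul_assoc, mul_one, one_mul, hd]
    simp only [mul_zero, add_zero, map_add, map_natCast]
    module

/-- With p ≤ a, V^a = V^(a-p) V^p, so V^p can be carried through (M V^a)^n one factor at a time
until it is absorbed by 1. -/
theorem genBesselPoly_eq_pow (a p : ℕ) (hp : p ≤ a) {d c : ℝ} {b β : R} (lam : R)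
    (hd : ((a + 1 : ℕ) : ℝ) * d = p) (hβ : algebraMap ℝ R c * β = b) (n : ℕ) :
    genBesselPoly (a + 1) d c b lam n = ((derivResolvent β ^ p *
      mulAffine (algebraMap ℝ R c) lam * derivResolvent β ^ (a - p)) ^ n) 1 := by
  rw [genBesselPoly_eq_derivResolvent _ p lam hd hβ]
  induction n with
  | zero => simp [genBesselPoly_zero, derivResolvent_pow_one]
  | succ n ih =>
    rw [pow_succ', Module.End.mul_apply, ← ih, genBesselPoly_zero_eq_pow _ _ hβ,
      genBesselPoly_zero_eq_pow _ _ hβ, pow_succ']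
    simp only [← Module.End.mul_apply]
    congr 1
    have e : derivResolvent β ^ a = derivResolvent β ^ (a - p) * derivResolvent β ^ p := by
      rw [← pow_add, Nat.sub_add_cancel hp]
    generalize (mulAffine (algebraMap ℝ R c) lam * derivResolvent β ^ a) ^ n = Q
    rw [e]
    simp only [mul_assoc]

/-- Translation by q commutes with D and sends X + λ to X + (λ + q), hence respects the recurrence.
-/
theorem genBesselPoly_taylor (a : ℕ) (d c : ℝ) (b lam q : R) (n : ℕ) :
    taylor q (genBesselPoly a d c b lam n) = genBesselPoly a d c b (lam + q) n := by
  induction n with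
  | zero => simp [genBesselPoly_zero]
  | succ n ih =>
    have hder : ∀ f : R[X], taylor q (derivative f) = derivative (taylor q f) := by
      intro f
      simp [taylor_apply, derivative_comp]
    rw [genBesselPoly_succ, genBesselPoly_succ, ← ih, ← hder]
    simp only [map_add, map_sub, taylor_mul, taylor_X, taylor_C]
    ring

theorem genBesselRow_eq (a : ℕ) (d c : ℝ) (b lam q : R) (n : ℕ) :
    genBesselRow a d c b lam q n = genBessel a d c b (lam + q) n 0 := by
  rw [← genBesselPoly_eval, ← genBesselPoly_coeff, ← genBesselPoly_taylor, taylor_coeff_zero]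

/-! ### Total positivity of the triangle -/

variable {S : Subsemiring R}

/-- The triangle is the d = 0 output array times the matrix of V^p. -/
theorem genBessel_isTP (hS : ∀ x : ℝ, 0 ≤ x → algebraMap ℝ R x ∈ S) {a p : ℕ} (ha : 0 < a)
    {d c : ℝ} (hd : (a : ℝ) * d = p) (hc : 0 < c) {b lam : R} (hb : b ∈ S) (hlam : lam ∈ S) :
    IsTP S (genBessel a d c b lam) := by
  obtain ⟨a, rfl⟩ := Nat.exists_eq_add_of_le' ha
  have hβ : algebraMap ℝ R c * (algebraMap ℝ R c⁻¹ * b) = b := by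
    rw [← mul_assoc, ← map_mul, mul_inv_cancel₀ hc.ne', map_one, one_mul]
  have hV := IsTP.derivResolvent hS (S.mul_mem (hS c⁻¹ (by positivity)) hb)
  have h0 := ((IsTP.mulAffine (hS c hc.le) hlam).opMatrix_mul (hV.opMatrix_pow a)).iterate_coeff
  refine IsTP.mul h0 (hV.opMatrix_pow p) fun i j => ?_
  simp only [← genBesselPoly_zero_eq_pow a lam hβ]
  refine ⟨(genBesselPoly (a + 1) 0 c b lam i).natDegree + 1, fun K' hK => ?_⟩
  rw [← genBesselPoly_coeff, genBesselPoly_eq_derivResolvent _ p lam hd hβ,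
    coeff_apply_eq_sum _ _ _ hK]

theorem genBessel_hankel_isTP (hS : ∀ x : ℝ, 0 ≤ x → algebraMap ℝ R x ∈ S) {a p : ℕ}
    (ha : 0 < a) {d c : ℝ} (hd : (a : ℝ) * d = p) (hp : p + 1 ≤ a) (hc : 0 < c) {b lam : R}
    (hb : b ∈ S) (hlam : lam ∈ S) :
    IsTP S fun i j => genBessel a d c b lam (i + j) 0 := by
  obtain ⟨a, rfl⟩ := Nat.exists_eq_add_of_le' ha
  have hβ : algebraMap ℝ R c * (algebraMap ℝ R c⁻¹ * b) = b := by
    rw [← mul_assoc, ← map_mul, mul_inv_cancel₀ hc.ne', map_one, one_mul]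
  have hV := IsTP.derivResolvent hS (S.mul_mem (hS c⁻¹ (by positivity)) hb)
  have h := (((hV.opMatrix_pow p).opMatrix_mul (IsTP.mulAffine (hS c hc.le) hlam)).opMatrix_mul
    (hV.opMatrix_pow (a - p))).iterate_hankel
  simpa only [← genBesselPoly_eq_pow a p (by omega) lam hd hβ, genBesselPoly_coeff] using h

end RowPolynomial

/-! ### Hankel total positivity and log-convexity -/

section LogConvex

variable {R : Type*} [CommRing R]

theorem det_fin_four (M : Matrix (Fin 4) (Fin 4) R) : M.det =
    M 0 0 * (M 1 1 * (M 2 2 * M 3 3 - M 2 3 * M 3 2) - M 1 2 * (M 2 1 * M 3 3 - M 2 3 * M 3 1)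
      + M 1 3 * (M 2 1 * M 3 2 - M 2 2 * M 3 1))
    - M 0 1 * (M 1 0 * (M 2 2 * M 3 3 - M 2 3 * M 3 2) - M 1 2 * (M 2 0 * M 3 3 - M 2 3 * M 3 0)
      + M 1 3 * (M 2 0 * M 3 2 - M 2 2 * M 3 0))
    + M 0 2 * (M 1 0 * (M 2 1 * M 3 3 - M 2 3 * M 3 1) - M 1 1 * (M 2 0 * M 3 3 - M 2 3 * M 3 0)
      + M 1 3 * (M 2 0 * M 3 1 - M 2 1 * M 3 0))
    - M 0 3 * (M 1 0 * (M 2 1 * M 3 2 - M 2 2 * M 3 1) - M 1 1 * (M 2 0 * M 3 2 - M 2 2 * M 3 0)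
      + M 1 2 * (M 2 0 * M 3 1 - M 2 1 * M 3 0)) := by
  rw [Matrix.det_succ_row_zero]
  simp [Fin.sum_univ_succ, Matrix.det_fin_three, Fin.succAbove]
  ring

theorem logConvexOp_iterate_mem {S : Subsemiring R} {α : ℕ → R}
    (h : IsTP S fun i j => α (i + j)) : ∀ m ≤ 3, ∀ n, logConvexOp^[m] α n ∈ S := by
  have hsm : ∀ (r n : ℕ), StrictMono fun i : Fin r => n + (i : ℕ) := fun r n i j hij => by
    have : (i : ℕ) < j := hij
    dsimp only; omega
  have hdet : ∀ r n, Matrix.det (Matrix.of fun i j : Fin r => α (n + i + j)) ∈ S := by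
    intro r n
    have := h r (fun i => n + i) (fun j => 0 + j) (hsm r n) (hsm r 0)
    simpa using this
  have hα : ∀ n, α n ∈ S := fun n => by simpa using hdet 1 n
  have h2 : ∀ n, α n * α (n + 2) - α (n + 1) ^ 2 ∈ S := fun n => by
    have := hdet 2 n
    rw [Matrix.det_fin_two] at this
    simp at this
    convert this using 1
    ring
  let D : ℕ → R := fun n => α n * (α (n + 2) * α (n + 4) - α (n + 3) ^ 2)
    - α (n + 1) * (α (n + 1) * α (n + 4) - α (n + 3) * α (n + 2))
    + α (n + 2) * (α (n + 1) * α (n + 3) - α (n + 2) ^ 2)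
  have h3 : ∀ n, D n ∈ S := fun n => by
    have := hdet 3 n
    rw [Matrix.det_fin_three] at this
    simp [add_assoc] at this
    convert this using 1
    ring
  let Q : ℕ → R := fun n => Matrix.det (Matrix.of fun i j : Fin 4 => α (n + i + j))
  -- The second iterate is an entry times a 3 × 3 Hankel minor.
  have e2 : ∀ n, logConvexOp^[2] α n = α (n + 2) * D n := fun n => by
    simp only [Function.iterate_succ, Function.iterate_zero, Function.comp, id, logConvexOp, D,
      add_assoc, Nat.reduceAdd]
    ring
  have e3 : ∀ n, logConvexOp^[3] α n = α (n + 2) * α (n + 4) *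
      ((α (n + 2) * α (n + 4) - α (n + 3) ^ 2) * Q n)
      + (α (n + 2) * α (n + 4) - α (n + 3) ^ 2) * D (n + 1) ^ 2 := fun n => by
    rw [Function.iterate_succ_apply', logConvexOp, e2, e2, e2]
    -- Desnanot–Jacobi identity for the 4 × 4 Hankel matrix; the first factor is its central 2 × 2
    -- minor.
    have hD : (α (n + 2) * α (n + 4) - α (n + 3) ^ 2) * Q n = D n * D (n + 2) - D (n + 1) ^ 2 := by
      simp only [Q, D, det_fin_four]
      simp [add_assoc]
      ring
    rw [hD]
    simp only [add_assoc, Nat.reduceAdd]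
    ring
  intro m hm n
  interval_cases m
  · exact hα n
  · simpa [logConvexOp] using h2 n
  · rw [e2]; exact S.mul_mem (hα _) (h3 n)
  · rw [e3]
    exact S.add_mem (S.mul_mem (S.mul_mem (hα _) (hα _)) (S.mul_mem (h2 (n + 2)) (hdet 4 n)))
      (S.mul_mem (h2 (n + 2)) (S.pow_mem (h3 _) 2))

end LogConvex

/-! ### Polynomials with nonnegative coefficients -/

section NonnegCoeffs

/-- The subsemiring of polynomials with nonnegative coefficients. -/
def nonnegCoeffsSubsemiring (σ : Type*) : Subsemiring (MvPolynomial σ ℝ) where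
  carrier := {P | NonnegCoeffs P}
  mul_mem' := by
    classical
    intro P Q hP hQ m
    rw [MvPolynomial.coeff_mul]
    exact Finset.sum_nonneg fun x _ => mul_nonneg (hP _) (hQ _)
  one_mem' := by
    classical
    intro m
    rw [MvPolynomial.coeff_one]
    split_ifs <;> norm_num
  add_mem' := by
    intro P Q hP hQ m
    rw [MvPolynomial.coeff_add]
    exact add_nonneg (hP m) (hQ m)
  zero_mem' := by intro m; simp

theorem algebraMap_mem_nonnegCoeffs (σ : Type*) (x : ℝ) (hx : 0 ≤ x) :
    algebraMap ℝ (MvPolynomial σ ℝ) x ∈ nonnegCoeffsSubsemiring σ := by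
  classical
  intro m
  rw [MvPolynomial.algebraMap_eq, MvPolynomial.coeff_C]
  split_ifs
  exacts [hx, le_rfl]

theorem X_mem_nonnegCoeffs {σ : Type*} (i : σ) :
    (MvPolynomial.X i : MvPolynomial σ ℝ) ∈ nonnegCoeffsSubsemiring σ := by
  classical
  intro m
  rw [MvPolynomial.coeff_X]
  split_ifs <;> norm_num

theorem CoeffTP_of_isTP {σ : Type*} {M : ℕ → ℕ → MvPolynomial σ ℝ}
    (h : IsTP (nonnegCoeffsSubsemiring σ) M) : CoeffTP M := h

theorem coeffTP_genBessel {a p : ℕ} (ha : 0 < a) {d c : ℝ} (hd : (a : ℝ) * d = p) (hc : 0 < c)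
    {σ : Type*} (i j : σ) :
    CoeffTP (genBessel a d c (MvPolynomial.X i : MvPolynomial σ ℝ) (MvPolynomial.X j)) :=
  CoeffTP_of_isTP (genBessel_isTP (algebraMap_mem_nonnegCoeffs σ) ha hd hc (X_mem_nonnegCoeffs i)
    (X_mem_nonnegCoeffs j))

theorem coeffSM_genBessel {σ : Type*} {a p : ℕ} (ha : 0 < a) {d c : ℝ} (hd : (a : ℝ) * d = p)
    (hp : p + 1 ≤ a) (hc : 0 < c) {b lam : MvPolynomial σ ℝ}
    (hb : b ∈ nonnegCoeffsSubsemiring σ) (hlam : lam ∈ nonnegCoeffsSubsemiring σ) :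
    CoeffSM (fun n => genBessel a d c b lam n 0) ∧
      CoeffLogConvex 3 (fun n => genBessel a d c b lam n 0) := by
  have h := genBessel_hankel_isTP (algebraMap_mem_nonnegCoeffs σ) ha hd hp hc hb hlam
  exact ⟨CoeffTP_of_isTP h, logConvexOp_iterate_mem (α := fun n => genBessel a d c b lam n 0) h⟩

end NonnegCoeffs

/-! ### Haviland's theorem on the half-line -/

section Haviland

open Polynomial Filter Topology
open scoped CompactlySupported NNReal ENNReal

/-- The linear functional on polynomials with given moments. -/
noncomputable def momentFunctional (α : ℕ → ℝ) : ℝ[X] →ₗ[ℝ] ℝ :=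
  (basisMonomials ℝ).constr ℝ α

theorem momentFunctional_X_pow (α : ℕ → ℝ) (n : ℕ) : momentFunctional α (X ^ n) = α n := by
  have := (basisMonomials ℝ).constr_basis ℝ α n
  simp only [coe_basisMonomials, monomial_one_right_eq_X_pow] at this
  exact this

theorem momentFunctional_eq_sum (α : ℕ → ℝ) (P : ℝ[X]) :
    momentFunctional α P = ∑ n ∈ Finset.range (P.natDegree + 1), P.coeff n * α n := by
  conv_lhs => rw [P.as_sum_range]
  rw [map_sum]
  refine Finset.sum_congr rfl fun n _ => ?_
  rw [← C_mul_X_pow_eq_monomial, ← smul_eq_C_mul, map_smul, momentFunctional_X_pow, smul_eq_mul]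

/-- The functional with moments `α` is nonnegative on polynomials nonnegative on `[0, ∞)`. -/
def IsMomentPositive (α : ℕ → ℝ) : Prop :=
  ∀ P : ℝ[X], (∀ x, 0 ≤ x → 0 ≤ P.eval x) → 0 ≤ momentFunctional α P

/-- The cone of pairs with nonnegative sum on the half-line. -/
noncomputable def nonnegPairCone : PointedCone ℝ (C_c(ℝ≥0, ℝ) × ℝ[X]) where
  carrier := {f | ∀ x : ℝ≥0, 0 ≤ f.1 x + f.2.eval (x : ℝ)}
  add_mem' := by
    intro f g hf hg x
    have h1 := hf x
    have h2 := hg x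
    simp only [Prod.fst_add, Prod.snd_add, CompactlySupportedContinuousMap.coe_add, Pi.add_apply,
      eval_add]
    linarith
  zero_mem' := by intro x; simp
  smul_mem' := by
    intro r f hf x
    have h1 := mul_nonneg r.2 (hf x)
    have : (r • f).1 x + (r • f).2.eval (x : ℝ) = (r : ℝ) * (f.1 x + f.2.eval (x : ℝ)) := by
      have e1 : (r • f).1 = (r : ℝ) • f.1 := rfl
      have e2 : (r • f).2 = (r : ℝ) • f.2 := rfl
      rw [e1, e2, CompactlySupportedContinuousMap.coe_smul, Pi.smul_apply, eval_smul, smul_eq_mul,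
        smul_eq_mul]
      ring
    rw [this]; exact h1

/-- The M. Riesz extension theorem, from 0 × ℝ[X] to pairs. A compactly supported f is bounded by
some B, so the polynomial B - P brings (f, P) into the cone. -/
theorem exists_extension_of_isMomentPositive {α : ℕ → ℝ} (h : IsMomentPositive α) :
    ∃ g : C_c(ℝ≥0, ℝ) × ℝ[X] →ₗ[ℝ] ℝ, (∀ P, g (0, P) = momentFunctional α P) ∧
      ∀ f P, (∀ x : ℝ≥0, 0 ≤ f x + P.eval (x : ℝ)) → 0 ≤ g (f, P) := by
  let f₀ : (C_c(ℝ≥0, ℝ) × ℝ[X]) →ₗ.[ℝ] ℝ :=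
    { domain := (⊥ : Submodule ℝ C_c(ℝ≥0, ℝ)).prod ⊤
      toFun := (momentFunctional α ∘ₗ LinearMap.snd ℝ _ _) ∘ₗ Submodule.subtype _ }
  have hnonneg : ∀ x : f₀.domain, (x : C_c(ℝ≥0, ℝ) × ℝ[X]) ∈ nonnegPairCone → 0 ≤ f₀ x := by
    rintro ⟨⟨f, P⟩, hfP⟩ hx
    have hf : f = 0 := by simpa [f₀] using hfP
    subst hf
    refine h P fun x hx0 => ?_
    have hx1 : 0 ≤ (0 : ℝ) + P.eval x := hx ⟨x, hx0⟩
    rwa [zero_add] at hx1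
  have hdense : ∀ y, ∃ x : f₀.domain, (x : C_c(ℝ≥0, ℝ) × ℝ[X]) + y ∈ nonnegPairCone := by
    rintro ⟨f, P⟩
    obtain ⟨B, hB⟩ := f.hasCompactSupport.exists_bound_of_continuous f.continuous
    refine ⟨⟨(0, C B - P), by simp [f₀]⟩, fun x => ?_⟩
    have := neg_le_of_abs_le (hB x)
    simp only [Prod.mk_add_mk, zero_add, eval_add, eval_sub, eval_C]
    linarith
  obtain ⟨g, hg, hg'⟩ := riesz_extension nonnegPairCone f₀ hnonneg hdense
  exact ⟨g, fun P => hg ⟨(0, P), by simp [f₀]⟩, fun f P hf => hg' (f, P) hf⟩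

/-- `x ^ n` cut off continuously between `N` and `N + 1`. -/
noncomputable def truncPow (n N : ℕ) : C_c(ℝ≥0, ℝ) where
  toFun x := (x : ℝ) ^ n * max 0 (min 1 ((N : ℝ) + 1 - (x : ℝ)))
  continuous_toFun := by fun_prop
  hasCompactSupport' := by
    refine HasCompactSupport.of_support_subset_isCompact
      (isCompact_Icc (a := (0 : ℝ≥0)) (b := (N + 1 : ℝ≥0))) fun x hx => ⟨zero_le, ?_⟩
    by_contra hlt
    push Not at hlt
    have : (N + 1 : ℝ) < x := by exact_mod_cast hlt
    apply hx
    dsimp only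
    rw [max_eq_left (min_le_of_right_le (by linarith)), mul_zero]

theorem truncPow_apply (n N : ℕ) (x : ℝ≥0) :
    truncPow n N x = (x : ℝ) ^ n * max 0 (min 1 ((N : ℝ) + 1 - (x : ℝ))) := rfl

theorem truncPow_nonneg (n N : ℕ) (x : ℝ≥0) : 0 ≤ truncPow n N x :=
  mul_nonneg (by positivity) (le_max_left _ _)

theorem truncPow_le (n N : ℕ) (x : ℝ≥0) : truncPow n N x ≤ (x : ℝ) ^ n := by
  rw [truncPow_apply]
  exact mul_le_of_le_one_right (by positivity) (max_le zero_le_one (min_le_left _ _))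

theorem truncPow_mono (n : ℕ) (x : ℝ≥0) : Monotone fun N => truncPow n N x := by
  intro N M hNM
  have : (N : ℝ) ≤ M := by exact_mod_cast hNM
  simp only [truncPow_apply]
  gcongr

theorem truncPow_eq (n N : ℕ) (x : ℝ≥0) (h : (x : ℝ) ≤ N) : truncPow n N x = (x : ℝ) ^ n := by
  rw [truncPow_apply, min_eq_left (by linarith), max_eq_right zero_le_one, mul_one]

/-- Where the cutoff acts, x > N + 1, so the next power divided by N + 1 dominates. This controls
the mass lost at infinity by the next moment. -/
theorem pow_le_truncPow_add (n N : ℕ) (x : ℝ≥0) :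
    (x : ℝ) ^ n ≤ truncPow n (N + 1) x + (x : ℝ) ^ (n + 1) / (N + 1) := by
  have hN : (0 : ℝ) < N + 1 := by positivity
  rcases le_or_gt (x : ℝ) (N + 1) with h | h
  · rw [truncPow_eq n (N + 1) x (by push_cast; exact h)]
    have : 0 ≤ (x : ℝ) ^ (n + 1) / (N + 1) := by positivity
    linarith
  · have h1 := truncPow_nonneg n (N + 1) x
    have : (x : ℝ) ^ n ≤ (x : ℝ) ^ (n + 1) / (N + 1) := by
      rw [le_div_iff₀ hN, pow_succ]
      gcongr
    linarith

/-- Haviland's theorem on the half-line. -/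
theorem IsMomentPositive.isStieltjesMoment {α : ℕ → ℝ} (h : IsMomentPositive α) :
    IsStieltjesMoment α := by
  obtain ⟨g, hg, hpos⟩ := exists_extension_of_isMomentPositive h
  let Λ : C_c(ℝ≥0, ℝ) →ₚ[ℝ] ℝ := PositiveLinearMap.mk₀ (g ∘ₗ LinearMap.inl ℝ _ _)
    (fun f hf => hpos f 0 fun x => by simpa using hf x)
  let ν := RealRMK.rieszMeasure Λ
  have hΛ : ∀ f : C_c(ℝ≥0, ℝ), ∫ x, f x ∂ν = g (f, 0) := fun f =>
    RealRMK.integral_rieszMeasure Λ f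
  have hsub : ∀ f P, g (f, P) = g (f, 0) + momentFunctional α P := fun f P => by
    rw [← hg, ← map_add]; simp
  have hup : ∀ n N, g (truncPow n N, 0) ≤ α n := fun n N => by
    have := hpos (-truncPow n N) (X ^ n) (fun x => by
      have := truncPow_le n N x
      simp; exact this)
    rw [hsub, momentFunctional_X_pow, show (-truncPow n N, (0 : ℝ[X])) = -(truncPow n N, 0) by simp,
      map_neg] at this
    linarith
  have hlow : ∀ n N : ℕ, α n - α (n + 1) / (N + 1) ≤ g (truncPow n (N + 1), 0) := fun n N => by
    have := hpos (truncPow n (N + 1)) (C (1 / (N + 1 : ℝ)) * X ^ (n + 1) - X ^ n) (fun x => by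
      have := pow_le_truncPow_add n N x
      simp only [eval_sub, eval_mul, eval_C, eval_pow, eval_X]
      rw [one_div_mul_eq_div]
      linarith)
    rw [hsub, map_sub, ← smul_eq_C_mul, map_smul, momentFunctional_X_pow, momentFunctional_X_pow,
      smul_eq_mul, one_div_mul_eq_div] at this
    linarith
  have hα : ∀ n, 0 ≤ α n := fun n => by
    have := h (X ^ n) (fun x hx => by simp; positivity)
    rwa [momentFunctional_X_pow] at this
  have hlim : ∀ n, Tendsto (fun N : ℕ => g (truncPow n (N + 1), 0)) atTop (𝓝 (α n)) := fun n => by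
    refine tendsto_of_tendsto_of_tendsto_of_le_of_le (g := fun N : ℕ => α n - α (n + 1) / (N + 1))
      (h := fun _ => α n) ?_ tendsto_const_nhds (fun N => hlow n N) (fun N => hup n _)
    have := (tendsto_one_div_add_atTop_nhds_zero_nat (𝕜 := ℝ)).const_mul (α (n + 1))
    simpa [div_eq_mul_inv] using this.const_sub (α n)
  -- Monotone convergence in the cutoff: the truncated integrals are values of `g`, which `hup` and
  -- `hlow` squeeze to α n.
  have hlint : ∀ n, ∫⁻ x : ℝ≥0, ENNReal.ofReal ((x : ℝ) ^ n) ∂ν = ENNReal.ofReal (α n) := fun n => by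
    have h1 : Tendsto (fun N : ℕ => ∫⁻ x, ENNReal.ofReal (truncPow n (N + 1) x) ∂ν) atTop
        (𝓝 (∫⁻ x : ℝ≥0, ENNReal.ofReal ((x : ℝ) ^ n) ∂ν)) := by
      refine lintegral_tendsto_of_tendsto_of_monotone (fun N => ?_) ?_ ?_
      · exact (truncPow n (N + 1)).continuous.measurable.ennreal_ofReal.aemeasurable
      · refine Eventually.of_forall fun x N M hNM => ENNReal.ofReal_le_ofReal ?_
        exact truncPow_mono n x (by omega)
      · refine Eventually.of_forall fun x => tendsto_const_nhds.congr' ?_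
        obtain ⟨N₀, hN₀⟩ := exists_nat_ge (x : ℝ)
        filter_upwards [eventually_ge_atTop N₀] with N hN
        rw [truncPow_eq]
        have : (N₀ : ℝ) ≤ N := by exact_mod_cast hN
        push_cast; linarith
    have h2 : ∀ N, ∫⁻ x, ENNReal.ofReal (truncPow n (N + 1) x) ∂ν =
        ENNReal.ofReal (g (truncPow n (N + 1), 0)) := fun N => by
      rw [← hΛ, ofReal_integral_eq_lintegral_ofReal]
      · exact (truncPow n (N + 1)).integrable
      · exact Eventually.of_forall fun x => truncPow_nonneg _ _ _
    simp only [h2] at h1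
    exact tendsto_nhds_unique h1 ((ENNReal.continuous_ofReal.tendsto _).comp (hlim n))
  have hint : ∀ n, Integrable (fun x : ℝ≥0 => (x : ℝ) ^ n) ν := fun n => by
    refine ⟨(by fun_prop : Continuous fun x : ℝ≥0 => (x : ℝ) ^ n).aestronglyMeasurable, ?_⟩
    rw [hasFiniteIntegral_iff_ofReal (Eventually.of_forall fun x => by positivity), hlint]
    exact ENNReal.ofReal_lt_top
  have hm : Measurable ((↑) : ℝ≥0 → ℝ) := NNReal.continuous_coe.measurable
  have hpm : ∀ n, AEStronglyMeasurable (fun x : ℝ => x ^ n) (ν.map (↑)) := fun n =>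
    (continuous_pow n).aestronglyMeasurable
  refine ⟨ν.map (↑), ?_, fun n => ⟨?_, ?_⟩⟩
  · rw [Measure.map_apply hm measurableSet_Iio]
    convert measure_empty (μ := ν)
    ext x; simp
  · rw [integrable_map_measure (hpm n) hm.aemeasurable]
    exact hint n
  · rw [integral_map hm.aemeasurable (hpm n), integral_eq_lintegral_of_nonneg_ae
      (Eventually.of_forall fun x => by positivity) (hint n).aestronglyMeasurable, hlint,
      ENNReal.toReal_ofReal (hα n)]

end Haviland

/-! ### Moment positivity from discrete approximation -/

section DiscreteApproximation

open Polynomial Filter Topology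

theorem IsMomentPositive.scale {α : ℕ → ℝ} (h : IsMomentPositive α) {r C : ℝ} (hr : 0 ≤ r)
    (hC : 0 ≤ C) : IsMomentPositive fun n => C * (r ^ n * α n) := by
  intro P hP
  have e : momentFunctional (fun n => C * (r ^ n * α n)) P =
      C * momentFunctional α (P.comp (Polynomial.C r * X)) := by
    have : momentFunctional (fun n => C * (r ^ n * α n)) =
        C • (momentFunctional α ∘ₗ (aeval (Polynomial.C r * X : ℝ[X])).toLinearMap) := by
      refine (basisMonomials ℝ).ext fun n => ?_
      simp only [coe_basisMonomials, monomial_one_right_eq_X_pow, momentFunctional_X_pow,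
        LinearMap.smul_apply, LinearMap.comp_apply, AlgHom.toLinearMap_apply, map_pow, aeval_X]
      rw [mul_pow, ← C_pow, ← smul_eq_C_mul, map_smul, momentFunctional_X_pow]
      rfl
    rw [this, comp_eq_aeval]
    rfl
  rw [e]
  refine mul_nonneg hC (h _ fun x hx => ?_)
  rw [eval_comp]
  refine hP _ ?_
  simp only [eval_mul, eval_C, eval_X]
  positivity

theorem isMomentPositive_pow {x : ℝ} (hx : 0 ≤ x) : IsMomentPositive fun n => x ^ n := by
  intro P hP
  rw [momentFunctional_eq_sum, ← eval_eq_sum_range]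
  exact hP x hx

theorem mul_descFactorial (m n : ℕ) :
    (m : ℝ) * m.descFactorial n = m.descFactorial (n + 1) + n * m.descFactorial n := by
  rw [Nat.descFactorial_succ]
  rcases le_or_gt n m with h | h
  · push_cast [h]; ring
  · simp [Nat.descFactorial_eq_zero_iff_lt.2 h]

/-- Mixed moments `∑ x ^ k (x)_n` with step `1 / (N + 1)`, in terms of factorial moments. -/
noncomputable def mixedMoment (μ : ℕ → ℝ) (N : ℕ) : ℕ → ℕ → ℝ
  | 0, n => μ n
  | k + 1, n => mixedMoment μ N k (n + 1) + n / (N + 1) * mixedMoment μ N k n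

/-- With h = 1/(N + 1) and step-h falling powers, x (x)_n = (x)_{n+1} + n h (x)_n, and the
correction vanishes as N → ∞. -/
theorem tendsto_mixedMoment (μ : ℕ → ℝ) (k : ℕ) : ∀ n,
    Tendsto (fun N => mixedMoment μ N k n) atTop (𝓝 (μ (k + n))) := by
  induction k with
  | zero => intro n; simp [mixedMoment]
  | succ k ih =>
    intro n
    have h0 : Tendsto (fun N : ℕ => (n : ℝ) / (N + 1)) atTop (𝓝 0) := by
      have := (tendsto_one_div_add_atTop_nhds_zero_nat (𝕜 := ℝ)).const_mul (n : ℝ)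
      simpa [div_eq_mul_inv] using this
    have := (ih (n + 1)).add (h0.mul (ih n))
    simpa [mixedMoment, add_assoc, add_comm 1 n, add_left_comm] using this

/-- If for each `N` a nonnegative measure on the lattice of step `1 / (N + 1)` has factorial
moments `μ`, then `μ` is moment positive. -/
theorem isMomentPositive_of_factorial_moments {μ : ℕ → ℝ} {w : ℕ → ℕ → ℝ}
    (hw : ∀ N m, 0 ≤ w N m)
    (h : ∀ N n : ℕ, HasSum (fun m : ℕ => (m.descFactorial n : ℝ) / (N + 1 : ℝ) ^ n * w N m) (μ n)) :
    IsMomentPositive μ := by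
  have hsum : ∀ N k n : ℕ, HasSum (fun m : ℕ => ((m : ℝ) / (N + 1)) ^ k *
      ((m.descFactorial n : ℝ) / (N + 1 : ℝ) ^ n * w N m)) (mixedMoment μ N k n) := by
    intro N k
    induction k with
    | zero => intro n; simpa [mixedMoment] using h N n
    | succ k ih =>
      intro n
      have := (ih (n + 1)).add ((ih n).mul_left ((n : ℝ) / (N + 1)))
      convert! this using 1
      funext m
      have hN : (N + 1 : ℝ) ≠ 0 := by positivity
      have e := mul_descFactorial m n
      have e' : (m : ℝ) / (N + 1) * ((m.descFactorial n : ℝ) / (N + 1 : ℝ) ^ n) =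
          (m.descFactorial (n + 1) : ℝ) / (N + 1 : ℝ) ^ (n + 1) +
          n / (N + 1) * ((m.descFactorial n : ℝ) / (N + 1 : ℝ) ^ n) := by
        rw [div_mul_div_comm, e, pow_succ]
        field_simp
      rw [pow_succ]
      linear_combination ((m : ℝ) / (N + 1)) ^ k * w N m * e'
  intro P hP
  rw [momentFunctional_eq_sum]
  have hlim : Tendsto (fun N => ∑ k ∈ Finset.range (P.natDegree + 1),
      P.coeff k * mixedMoment μ N k 0) atTop
      (𝓝 (∑ k ∈ Finset.range (P.natDegree + 1), P.coeff k * μ k)) :=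
    tendsto_finsetSum _ fun k _ => (tendsto_mixedMoment μ k 0).const_mul _
  -- Before the limit the value is already ∑ P(m/(N+1)) w(N, m), a sum of nonnegative terms.
  refine ge_of_tendsto' hlim fun N => ?_
  have hs := hasSum_sum fun k (_ : k ∈ Finset.range (P.natDegree + 1)) =>
    (hsum N k 0).mul_left (P.coeff k)
  refine hs.nonneg fun m => ?_
  have : ∑ k ∈ Finset.range (P.natDegree + 1), P.coeff k * (((m : ℝ) / (N + 1)) ^ k *
      ((m.descFactorial 0 : ℝ) / (N + 1 : ℝ) ^ 0 * w N m)) =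
      P.eval ((m : ℝ) / (N + 1)) * w N m := by
    rw [eval_eq_sum_range, Finset.sum_mul]
    refine Finset.sum_congr rfl fun k _ => ?_
    simp
    ring
  rw [this]
  exact mul_nonneg (hP _ (by positivity)) (hw N m)

end DiscreteApproximation

/-! ### Moment positivity of the zeroth column -/

section ZerothColumn

open Polynomial Filter Topology

theorem genBessel_nonneg {a p : ℕ} (ha : 0 < a) {d c : ℝ} (hd : (a : ℝ) * d = p) (hc : 0 < c)
    {b lam : ℝ} (hb : 0 ≤ b) (hlam : 0 ≤ lam) (n k : ℕ) : 0 ≤ genBessel a d c b lam n k := by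
  have h := genBessel_isTP (S := Subsemiring.nonneg ℝ) (fun x hx => by simpa using hx) ha hd hc
    (b := b) (lam := lam) (by simpa using hb) (by simpa using hlam)
  have := h 1 (fun _ => n) (fun _ => k) (Subsingleton.strictMono _) (Subsingleton.strictMono _)
  simpa using this

/-- `w ^ (-n - d) exp (-(c y / b) w ^ (1 / a)) Q_n (y w ^ (1 / a))` with `Q_n` the `n`-th row
polynomial at `lam = 0`; up to constants, the derivatives of the function with `n = 0`. -/
noncomputable def besselKernel (a : ℕ) (d c b y : ℝ) (n : ℕ) (w : ℂ) : ℂ :=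
  Complex.exp (-(n + d) * Complex.log w -
      (c * y / b) * Complex.exp ((1 / a : ℂ) * Complex.log w)) *
    aeval (y * Complex.exp ((1 / a : ℂ) * Complex.log w)) (genBesselPoly a d c b (0 : ℝ) n)

/-- Differentiating produces -(1/(ab)) w⁻¹ times ab(n + d)Q + u(cQ - bQ') at u = y w^(1/a), which is
the row recurrence at λ = 0. -/
theorem hasDerivAt_besselKernel {a : ℕ} (ha : 0 < a) (d c : ℝ) {b : ℝ} (hb : 0 < b) (y : ℝ) (n : ℕ)
    {w : ℂ} (hw : 0 < w.re) :
    HasDerivAt (besselKernel a d c b y n) (-1 / (a * b) * besselKernel a d c b y (n + 1) w) w := by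
  have hw' : w ∈ Complex.slitPlane := Or.inl hw
  have hw0 : w ≠ 0 := Complex.slitPlane_ne_zero hw'
  have ha' : (a : ℂ) ≠ 0 := by exact_mod_cast ha.ne'
  have hb' : (b : ℂ) ≠ 0 := by exact_mod_cast hb.ne'
  have hlog := Complex.hasDerivAt_log hw'
  have he := (hlog.const_mul (1 / a : ℂ)).cexp
  have h1 := ((hlog.const_mul (-(n + d) : ℂ)).sub (he.const_mul (c * y / b : ℂ))).cexp
  have hQ := ((genBesselPoly a d c b (0 : ℝ) n).hasDerivAt_aeval
    (y * Complex.exp ((1 / a : ℂ) * Complex.log w))).comp w (he.const_mul (y : ℂ))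
  have h := h1.mul hQ
  refine h.congr_deriv ?_
  simp only [besselKernel, genBesselPoly_succ, map_add, map_mul, map_sub, aeval_X, aeval_C,
    Function.comp, C_0, add_zero, Pi.sub_apply, Algebra.algebraMap_self, RingHom.id_apply]
  set s := Complex.log w with hs
  set e := Complex.exp ((1 / a : ℂ) * s) with hed
  set Q := aeval (y * e : ℂ) (genBesselPoly a d c b (0 : ℝ) n)
  set Q' := aeval (y * e : ℂ) (derivative (genBesselPoly a d c b (0 : ℝ) n))
  have hexp : Complex.exp (-(((n + 1 : ℕ) : ℂ) + d) * s - c * y / b * e) =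
      w⁻¹ * Complex.exp (-(n + d) * s - c * y / b * e) := by
    rw [← Complex.exp_log hw0, ← Complex.exp_neg, ← Complex.exp_add, ← hs]
    congr 1
    push_cast; ring
  rw [hexp]
  simp only [Complex.coe_algebraMap, Complex.ofReal_natCast]
  generalize Complex.exp (-(n + d) * s - c * y / b * e) = Y
  field_simp
  ring

theorem iteratedDeriv_besselKernel {a : ℕ} (ha : 0 < a) (d c : ℝ) {b : ℝ} (hb : 0 < b) (y : ℝ)
    (n j : ℕ) {w : ℂ} (hw : 0 < w.re) :
    iteratedDeriv j (besselKernel a d c b y n) w =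
      (-1 / (a * b)) ^ j * besselKernel a d c b y (n + j) w := by
  induction j generalizing w with
  | zero => simp
  | succ j ih =>
    rw [iteratedDeriv_succ]
    have hev : iteratedDeriv j (besselKernel a d c b y n) =ᶠ[𝓝 w]
        fun z => (-1 / (a * b)) ^ j * besselKernel a d c b y (n + j) z := by
      filter_upwards [(isOpen_lt continuous_const Complex.continuous_re).mem_nhds hw] with z hz
      exact ih hz
    rw [hev.deriv_eq, ((hasDerivAt_besselKernel ha d c hb y (n + j) hw).const_mul _).deriv]
    rw [pow_succ, mul_assoc, add_assoc]

/-- The real version of `besselKernel` on the positive half-line. -/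
noncomputable def realBesselKernel (a : ℕ) (d c b y : ℝ) (n : ℕ) (w : ℝ) : ℝ :=
  Real.exp (-(n + d) * Real.log w - (c * y / b) * Real.exp ((1 / a : ℝ) * Real.log w)) *
    (genBesselPoly a d c b (0 : ℝ) n).eval (y * Real.exp ((1 / a : ℝ) * Real.log w))

theorem besselKernel_ofReal (a : ℕ) (d c b y : ℝ) (n : ℕ) {w : ℝ} (hw : 0 ≤ w) :
    besselKernel a d c b y n w = realBesselKernel a d c b y n w := by
  rw [besselKernel, realBesselKernel, ← Complex.ofReal_log hw, Complex.ofReal_mul,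
    ← Complex.coe_algebraMap, ← aeval_algebraMap_apply_eq_algebraMap_eval]
  simp only [Complex.coe_algebraMap]
  push_cast
  rfl

/-- The disc of centre and radius 1 + r lies in the right half-plane, where the kernel is
holomorphic, and contains 1. The Taylor signs (-r)^j and (-1/(ab))^j cancel. -/
theorem hasSum_realBesselKernel {a : ℕ} (ha : 0 < a) (d c : ℝ) {b : ℝ} (hb : 0 < b) (y : ℝ)
    (n : ℕ) {r : ℝ} (hr : 0 < r) :
    HasSum (fun j : ℕ => (r / (a * b)) ^ j / (j.factorial : ℝ) *
      realBesselKernel a d c b y (n + j) (1 + r)) (realBesselKernel a d c b y n 1) := by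
  have hball : ∀ z ∈ Metric.ball ((1 + r : ℝ) : ℂ) (1 + r), 0 < z.re := by
    intro z hz
    rw [mem_ball_iff_norm'] at hz
    have h1 := (Complex.abs_re_le_norm _).trans_lt hz
    simp only [Complex.sub_re, Complex.ofReal_re] at h1
    have := (abs_lt.1 h1).2
    linarith
  have hd : DifferentiableOn ℂ (besselKernel a d c b y n) (Metric.ball ((1 + r : ℝ) : ℂ) (1 + r)) :=
    fun z hz => (hasDerivAt_besselKernel ha d c hb y n (hball z hz)).differentiableAt.differentiableWithinAt
  have h1 : (1 : ℂ) ∈ Metric.ball ((1 + r : ℝ) : ℂ) (1 + r) := by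
    rw [mem_ball_iff_norm']
    simp [abs_of_pos hr]
  have h := Complex.hasSum_taylorSeries_on_ball hd h1
  rw [← Complex.hasSum_ofReal, ← besselKernel_ofReal _ _ _ _ _ _ zero_le_one, Complex.ofReal_one]
  convert! h using 1
  funext j
  rw [iteratedDeriv_besselKernel ha d c hb y n j (by simp; linarith),
    besselKernel_ofReal _ _ _ _ _ _ (by linarith)]
  have ha' : (a : ℂ) ≠ 0 := by exact_mod_cast ha.ne'
  have hb' : (b : ℂ) ≠ 0 := by exact_mod_cast hb.ne'
  push_cast
  rw [show (1 - (1 + r) : ℂ) = -r by ring, smul_eq_mul, smul_eq_mul]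
  have : (r / (a * b) : ℂ) ^ j = (-r) ^ j * (-1 / (a * b)) ^ j := by
    rw [← mul_pow]; congr 1; ring
  rw [this]
  ring

theorem realBesselKernel_one (a : ℕ) (d c b y : ℝ) (n : ℕ) :
    realBesselKernel a d c b y n 1 = Real.exp (-(c * y / b)) * genBessel a d c b y n 0 := by
  rw [realBesselKernel, genBesselPoly_eval]
  simp [genBesselRow_eq]

theorem isMomentPositive_genBessel {a p : ℕ} (ha : 0 < a) {d c : ℝ} (hd : (a : ℝ) * d = p)
    (hc : 0 < c) {b y : ℝ} (hb : 0 ≤ b) (hy : 0 ≤ y) :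
    IsMomentPositive fun n => genBessel a d c b y n 0 := by
  rcases hb.eq_or_lt with rfl | hb
  -- The kernel divides by b; at b = 0 the sequence is that of a point mass at cy.
  · have : (fun n => genBessel a d c (0 : ℝ) y n 0) = fun n => (c * y) ^ n := by
      funext n
      induction n with
      | zero => simp [genBessel]
      | succ n ih => rw [genBessel, ih, pow_succ]; simp; ring
    rw [this]
    exact isMomentPositive_pow (by positivity)
  have ha' : (0 : ℝ) < a := by exact_mod_cast ha
  have hG : ∀ n (w : ℝ), 0 ≤ realBesselKernel a d c b y n w := by
    intro n w
    refine mul_nonneg (Real.exp_nonneg _) ?_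
    rw [eval_eq_sum_range]
    refine Finset.sum_nonneg fun k _ => ?_
    rw [genBesselPoly_coeff]
    have := genBessel_nonneg ha hd hc hb.le le_rfl n k
    positivity
  have key : IsMomentPositive fun n => (a * b : ℝ)⁻¹ ^ n * realBesselKernel a d c b y n 1 := by
    refine isMomentPositive_of_factorial_moments (w := fun N m => ((N + 1 : ℝ) / (a * b)) ^ m /
      (m.factorial : ℝ) * realBesselKernel a d c b y m (1 + (N + 1))) ?_ ?_
    · intro N m
      have := hG m (1 + (N + 1))
      positivity
    · intro N n
      have hN : (0 : ℝ) < N + 1 := by positivity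
      have h := (hasSum_realBesselKernel ha d c hb y n hN).mul_left ((a * b : ℝ)⁻¹ ^ n)
      -- Terms with m < n vanish through the falling factorial, so put m = n + j and recover the
      -- Taylor series.
      rw [← (add_right_injective n).hasSum_iff]
      · convert! h using 1
        funext j
        simp only [Function.comp]
        have e : (((n + j).descFactorial n : ℕ) : ℝ) * (j.factorial : ℝ) = (n + j).factorial := by
          have := Nat.factorial_mul_descFactorial (Nat.le_add_right n j)
          rw [Nat.add_sub_cancel_left] at this
          rw [← this]; push_cast; ring
        have hj : (j.factorial : ℝ) ≠ 0 := by positivity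
        have hnj : ((n + j).factorial : ℝ) ≠ 0 := by positivity
        have e2 : (((n + j).descFactorial n : ℕ) : ℝ) / (n + j).factorial = 1 / j.factorial := by
          rw [div_eq_div_iff hnj hj, e, one_mul]
        have e3 : ((N + 1 : ℝ) / (a * b)) ^ (n + j) =
            (N + 1 : ℝ) ^ n * ((a * b : ℝ)⁻¹ ^ n * ((N + 1 : ℝ) / (a * b)) ^ j) := by
          rw [pow_add, div_pow, div_eq_mul_inv, ← inv_pow]; ring
        rw [e3]
        have hNn : (N + 1 : ℝ) ^ n ≠ 0 := by positivity
        calc _ = ((N + 1 : ℝ) ^ n / (N + 1 : ℝ) ^ n) * ((((n + j).descFactorial n : ℕ) : ℝ) /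
              (n + j).factorial) * ((a * b : ℝ)⁻¹ ^ n * ((N + 1 : ℝ) / (a * b)) ^ j *
              realBesselKernel a d c b y (n + j) (1 + (N + 1))) := by ring
          _ = _ := by rw [div_self hNn, e2]; ring
      · intro m hm
        have : m < n := by
          by_contra hlt
          push Not at hlt
          exact hm ⟨m - n, by simp; omega⟩
        simp [Nat.descFactorial_eq_zero_iff_lt.2 this]
  have h := key.scale (r := a * b) (C := Real.exp (c * y / b)) (by positivity) (Real.exp_nonneg _)
  convert h using 1
  funext n
  rw [realBesselKernel_one, ← mul_assoc ((a * b : ℝ) ^ n), ← mul_pow,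
    mul_inv_cancel₀ (by positivity), one_pow, one_mul, ← mul_assoc, ← Real.exp_add]
  simp

end ZerothColumn

/-! ### Preservation of the Stieltjes moment property -/

section Convolution

open Polynomial

/-- The (n, k) entry is homogeneous of degree n - k in b and λ. Truncated subtraction is harmless
because entries above the diagonal vanish. -/
theorem genBessel_mul {R : Type*} [CommRing R] [Algebra ℝ R] (a : ℕ) (d c : ℝ) (b lam t : R)
    (n : ℕ) : ∀ k, genBessel a d c (t * b) (t * lam) n k =
      genBessel a d c b lam n k * t ^ (n - k) := by
  induction n with
  | zero => intro k; cases k <;> simp [genBessel]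
  | succ n ih =>
    have h1 : ∀ k, genBessel a d c b lam n k * t ^ (n + 1 - k) =
        genBessel a d c b lam n k * t ^ (n - k) * t := fun k => by
      rcases le_or_gt k n with h | h
      · rw [Nat.succ_sub h, pow_succ, mul_assoc]
      · simp [genBessel_eq_zero_of_lt _ _ _ _ _ _ _ h]
    have h2 : ∀ k, genBessel a d c b lam n (k + 1) * t ^ (n + 1 - k) =
        genBessel a d c b lam n (k + 1) * t ^ (n - (k + 1)) * t ^ 2 := fun k => by
      rcases le_or_gt (k + 1) n with h | h
      · rw [mul_assoc, ← pow_add]; congr 2; omega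
      · simp [genBessel_eq_zero_of_lt _ _ _ _ _ _ _ h]
    intro k
    cases k with
    | zero =>
      have e1 := h1 0
      have e2 := h2 0
      simp only [Nat.sub_zero, zero_add] at e1 e2
      rw [genBessel, genBessel, ih, ih]
      simp only [Algebra.smul_def, Nat.sub_zero]
      linear_combination -(algebraMap ℝ R (a * n + a * d) * b + algebraMap ℝ R c * lam) * e1 +
        b * lam * e2
    | succ k =>
      have e1 := h1 (k + 1)
      have e2 := h2 (k + 1)
      simp only [Nat.add_sub_add_right] at e1 e2
      rw [genBessel, genBessel, ih, ih, ih, Nat.add_sub_add_right]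
      simp only [Algebra.smul_def]
      linear_combination -(algebraMap ℝ R (a * n - (k + 1) + a * d) * b + algebraMap ℝ R c * lam) *
        e1 + (k + 2) * (b * lam) * e2

theorem sum_genBessel_mul_pow {R : Type*} [CommRing R] [Algebra ℝ R] (a : ℕ) (d c : ℝ)
    (b lam s t : R) (n : ℕ) :
    ∑ k ∈ Finset.range (n + 1), genBessel a d c b lam n k * s ^ k * t ^ (n - k) =
      genBessel a d c (t * b) (t * lam + s) n 0 := by
  rw [← genBesselRow_eq, genBesselRow]
  refine Finset.sum_congr rfl fun k _ => ?_
  rw [genBessel_mul]; ring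

theorem IsStieltjesMoment.of_moments {α : ℕ → ℝ} (h : IsStieltjesMoment α) :
    ∃ μ : Measure ℝ, IsFiniteMeasure μ ∧ (∀ᵐ x ∂μ, 0 ≤ x) ∧
      ∀ n : ℕ, Integrable (fun x : ℝ => x ^ n) μ ∧ ∫ x, x ^ n ∂μ = α n := by
  obtain ⟨μ, h0, hμ⟩ := h
  refine ⟨μ, ?_, ?_, hμ⟩
  · have := (hμ 0).1
    simp only [pow_zero] at this
    simpa using (integrable_const_iff.1 this)
  · rw [ae_iff]
    simpa [Set.Iio] using h0

theorem convolutionPreservesSM_genBessel {a p : ℕ} (ha : 0 < a) {d c : ℝ} (hd : (a : ℝ) * d = p)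
    (hc : 0 < c) {b lam : ℝ} (hb : 0 ≤ b) (hlam : 0 ≤ lam) :
    ConvolutionPreservesSM (genBessel a d c b lam) := by
  intro x y hx hy
  obtain ⟨μ, hμf, hμ0, hμ⟩ := hx.of_moments
  obtain ⟨ν, hνf, hν0, hν⟩ := hy.of_moments
  refine IsMomentPositive.isStieltjesMoment fun P hP => ?_
  have hint : ∀ n k : ℕ, Integrable (fun z : ℝ × ℝ => z.1 ^ k * z.2 ^ (n - k)) (μ.prod ν) :=
    fun n k => (hμ k).1.mul_prod (hν (n - k)).1
  have hval : ∀ n k : ℕ, ∫ z : ℝ × ℝ, z.1 ^ k * z.2 ^ (n - k) ∂(μ.prod ν) = x k * y (n - k) :=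
    fun n k => by
      rw [← (hμ k).2, ← (hν (n - k)).2]
      exact integral_prod_mul (fun s : ℝ => s ^ k) (fun t : ℝ => t ^ (n - k))
  -- For each (s, t) = z the integrand is the functional of the zeroth column at (tb, tλ + s),
  -- nonnegative when s, t ≥ 0.
  have key : momentFunctional (fun n => ∑ k ∈ Finset.range (n + 1),
      genBessel a d c b lam n k * x k * y (n - k)) P =
      ∫ z : ℝ × ℝ, momentFunctional
        (fun n => genBessel a d c (z.2 * b) (z.2 * lam + z.1) n 0) P ∂(μ.prod ν) := by
    simp only [momentFunctional_eq_sum, ← sum_genBessel_mul_pow, mul_assoc]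
    rw [integral_finsetSum]
    · refine Finset.sum_congr rfl fun n _ => ?_
      rw [integral_const_mul, integral_finsetSum]
      · congr 1
        refine Finset.sum_congr rfl fun k _ => ?_
        rw [integral_const_mul, hval]
      · exact fun k _ => (hint n k).const_mul _
    · exact fun n _ => (integrable_finsetSum _ fun k _ => (hint n k).const_mul _).const_mul _
  rw [key]
  refine integral_nonneg_of_ae ?_
  have h1 : ∀ᵐ z ∂(μ.prod ν), 0 ≤ z.1 := Measure.quasiMeasurePreserving_fst.ae hμ0
  have h2 : ∀ᵐ z ∂(μ.prod ν), 0 ≤ z.2 := Measure.quasiMeasurePreserving_snd.ae hν0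
  filter_upwards [h1, h2] with z hz1 hz2
  exact isMomentPositive_genBessel ha hd hc (by positivity) (by positivity) P hP

end Convolution

/-! ### The explicit formula -/

section Explicit

open Polynomial

/-- Taylor coefficients at λ of the row polynomial taken at λ = 0. -/
theorem genBessel_hasSum_shift (a : ℕ) (d c b lam : ℝ) (n k : ℕ) :
    HasSum (fun j : ℕ => ((k + j).choose k : ℝ) * lam ^ j * genBessel a d c b 0 n (k + j))
      (genBessel a d c b lam n k) := by
  have h : genBessel a d c b lam n k = ∑ j ∈ Finset.range (n + 1),
      ((k + j).choose k : ℝ) * lam ^ j * genBessel a d c b 0 n (k + j) := by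
    rw [← genBesselPoly_coeff, ← zero_add lam, ← genBesselPoly_taylor, taylor_coeff,
      eval_eq_sum_range' (n := n + 1)]
    · refine Finset.sum_congr rfl fun j _ => ?_
      rw [hasseDeriv_coeff, genBesselPoly_coeff, add_comm j k, zero_add]
      ring
    · refine Nat.lt_succ_of_le ((natDegree_hasseDeriv_le _ _).trans
        ((Nat.sub_le _ _).trans (natDegree_le_iff_coeff_eq_zero.2 fun m hm => ?_)))
      rw [genBesselPoly_coeff, genBessel_eq_zero_of_lt _ _ _ _ _ _ _ hm]
  rw [h]
  refine hasSum_sum_of_ne_finset_zero fun j hj => ?_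
  rw [genBessel_eq_zero_of_lt _ _ _ _ _ _ (k + j) (by simp at hj; omega), mul_zero]

/-- The alternating binomial sum in the explicit formula. -/
noncomputable def alternatingSum (a : ℕ) (d : ℝ) (n m : ℕ) : ℝ :=
  ∑ i ∈ Finset.range (m + 1), (-1 : ℝ) ^ (n + i) * (m.choose i : ℝ) *
    ((a : ℝ) ^ n * (descPochhammer ℝ n).eval (((i : ℝ) - a * d) / a))

theorem alternatingSum_zero (a : ℕ) (d : ℝ) (m : ℕ) :
    alternatingSum a d 0 m = if m = 0 then 1 else 0 := by
  have h := congrArg (fun z : ℤ => (z : ℝ)) (Int.alternating_sum_range_choose (n := m))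
  push_cast at h
  simpa [alternatingSum] using h

theorem alternatingSum_term {a : ℕ} (ha : 0 < a) (d : ℝ) (n i : ℕ) :
    (-1 : ℝ) ^ (n + 1 + i) *
      ((a : ℝ) ^ (n + 1) * (descPochhammer ℝ (n + 1)).eval (((i : ℝ) - a * d) / a)) =
    (a * n + a * d - i) * ((-1 : ℝ) ^ (n + i) *
      ((a : ℝ) ^ n * (descPochhammer ℝ n).eval (((i : ℝ) - a * d) / a))) := by
  have ha' : (a : ℝ) ≠ 0 := by exact_mod_cast ha.ne'
  rw [descPochhammer_succ_right, eval_mul, eval_sub, eval_X, eval_natCast]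
  generalize (descPochhammer ℝ n).eval (((i : ℝ) - a * d) / a) = D
  rw [show n + 1 + i = n + i + 1 by ring, pow_succ, pow_succ]
  field_simp
  ring

theorem alternatingSum_succ_zero {a : ℕ} (ha : 0 < a) (d : ℝ) (n : ℕ) :
    alternatingSum a d (n + 1) 0 = (a * n + a * d) * alternatingSum a d n 0 := by
  have := alternatingSum_term ha d n 0
  simpa [alternatingSum] using this

theorem alternatingSum_succ_succ {a : ℕ} (ha : 0 < a) (d : ℝ) (n m : ℕ) :
    alternatingSum a d (n + 1) (m + 1) =
      (a * n + a * d - (m + 1)) * alternatingSum a d n (m + 1) +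
        (m + 1) * alternatingSum a d n m := by
  let F : ℕ → ℝ := fun i => (-1 : ℝ) ^ (n + i) *
    ((a : ℝ) ^ n * (descPochhammer ℝ n).eval (((i : ℝ) - a * d) / a))
  have h1 : alternatingSum a d (n + 1) (m + 1) = ∑ i ∈ Finset.range (m + 2),
      ((m + 1).choose i : ℝ) * ((a * n + a * d - i) * F i) :=
    Finset.sum_congr rfl fun i _ => by
      rw [mul_right_comm, alternatingSum_term ha]; ring
  have h2 : ∀ m, alternatingSum a d n m = ∑ i ∈ Finset.range (m + 1), (m.choose i : ℝ) * F i :=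
    fun m => Finset.sum_congr rfl fun i _ => by ring
  -- Absorption: (m + 1) C(m, i) = (m + 1 - i) C(m + 1, i). The factor an + ad - i then splits as
  -- (an + ad - (m + 1)) + (m + 1 - i).
  have h3 : (m + 1) * alternatingSum a d n m = ∑ i ∈ Finset.range (m + 2),
      ((m + 1).choose i : ℝ) * ((m + 1 - i) * F i) := by
    rw [h2, Finset.sum_range_succ _ (m + 1), Finset.mul_sum]
    simp only [Nat.cast_add, Nat.cast_one, sub_self, zero_mul, mul_zero, add_zero]
    refine Finset.sum_congr rfl fun i hi => ?_
    have hi' : i ≤ m + 1 := by simp at hi; omega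
    have := Nat.choose_mul_succ_eq m i
    have := congrArg (fun z : ℕ => (z : ℝ)) this
    push_cast [hi'] at this
    linear_combination F i * this
  rw [h1, h3, h2, Finset.mul_sum, ← Finset.sum_add_distrib]
  exact Finset.sum_congr rfl fun i _ => by ring

/-- Up to sign, an m-th finite difference of a polynomial of degree n < m. This makes the value
given to negative powers of b, and to truncated exponents, irrelevant. -/
theorem alternatingSum_eq_zero_of_lt {a : ℕ} (ha : 0 < a) (d : ℝ) (n : ℕ) :
    ∀ m, n < m → alternatingSum a d n m = 0 := by
  induction n with
  | zero => intro m hm; rw [alternatingSum_zero, if_neg hm.ne']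
  | succ n ih =>
    intro m hm
    obtain ⟨m, rfl⟩ := Nat.exists_eq_add_of_lt (Nat.zero_lt_of_lt hm)
    rw [zero_add] at hm ⊢
    rw [alternatingSum_succ_succ ha, ih _ (by omega), ih _ (by omega)]
    simp

theorem genBessel_eq_alternatingSum {a : ℕ} (ha : 0 < a) (d c b : ℝ) (n : ℕ) : ∀ m,
    genBessel a d c b 0 n m =
      b ^ (n - m) * c ^ m * (alternatingSum a d n m / (m.factorial : ℝ)) := by
  induction n with
  | zero =>
    intro m
    rw [alternatingSum_zero]
    cases m <;> simp [genBessel]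
  | succ n ih =>
    intro m
    cases m with
    | zero =>
      rw [genBessel, ih, ih, alternatingSum_succ_zero ha]
      simp only [smul_eq_mul, Nat.sub_zero, pow_succ]
      simp
      ring
    | succ m =>
      rw [genBessel, ih, ih, ih, alternatingSum_succ_succ ha, Nat.add_sub_add_right,
        Nat.factorial_succ]
      have hf : (m.factorial : ℝ) ≠ 0 := by positivity
      have hm : (m + 1 : ℝ) ≠ 0 := by positivity
      have e : b ^ (n - (m + 1)) * b * alternatingSum a d n (m + 1) =
          b ^ (n - m) * alternatingSum a d n (m + 1) := by
        rcases le_or_gt (m + 1) n with h | h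
        · rw [← pow_succ]; congr 2; omega
        · rw [alternatingSum_eq_zero_of_lt ha d n _ h]; simp
      simp only [smul_eq_mul, mul_zero, add_zero, zero_mul, sub_zero, Nat.cast_mul, Nat.cast_add,
        Nat.cast_one]
      field_simp
      linear_combination c * c ^ m * (a * n - (m + 1) + a * d) * e

theorem genBessel_hasSum {a : ℕ} (ha : 0 < a) (d c b lam : ℝ) (n k : ℕ) :
    HasSum
      (fun j : ℕ => (a : ℝ) ^ n / (k.factorial : ℝ) *
        ∑ i ∈ Finset.range (k + j + 1),
          (-1 : ℝ) ^ ((n : ℤ) - (i : ℤ)) * b ^ ((n : ℤ) - (k : ℤ) - (j : ℤ)) * c ^ (k + j) *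
            lam ^ j / (j.factorial : ℝ) * ((k + j).choose i : ℝ) *
            (descPochhammer ℝ n).eval (((i : ℝ) - a * d) / a))
      (genBessel a d c b lam n k) := by
  convert genBessel_hasSum_shift a d c b lam n k using 1
  funext j
  have hsign : ∀ i : ℕ, (-1 : ℝ) ^ ((n : ℤ) - (i : ℤ)) = (-1) ^ (n + i) := fun i => by
    rw [zpow_sub₀ (by norm_num), zpow_natCast, zpow_natCast, pow_add, div_eq_mul_inv, ← inv_pow]
    norm_num
  have hsum : (a : ℝ) ^ n / (k.factorial : ℝ) *
        ∑ i ∈ Finset.range (k + j + 1),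
          (-1 : ℝ) ^ ((n : ℤ) - (i : ℤ)) * b ^ ((n : ℤ) - (k : ℤ) - (j : ℤ)) * c ^ (k + j) *
            lam ^ j / (j.factorial : ℝ) * ((k + j).choose i : ℝ) *
            (descPochhammer ℝ n).eval (((i : ℝ) - a * d) / a) =
      (b ^ ((n : ℤ) - (k : ℤ) - (j : ℤ)) * alternatingSum a d n (k + j)) * c ^ (k + j) * lam ^ j /
        ((k.factorial : ℝ) * (j.factorial : ℝ)) := by
    rw [alternatingSum]
    simp only [Finset.mul_sum, Finset.sum_mul, Finset.sum_div]
    refine Finset.sum_congr rfl fun i _ => ?_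
    rw [hsign]
    field_simp
  have hb : b ^ ((n : ℤ) - (k : ℤ) - (j : ℤ)) * alternatingSum a d n (k + j) =
      b ^ (n - (k + j)) * alternatingSum a d n (k + j) := by
    rcases le_or_gt (k + j) n with h | h
    · rw [← zpow_natCast b (n - (k + j)), Nat.cast_sub h]
      congr 2; push_cast; ring
    · rw [alternatingSum_eq_zero_of_lt ha d n _ h]; simp
  have hc := congrArg (fun z : ℕ => (z : ℝ)) (Nat.add_choose_mul_factorial_mul_factorial k j)
  rw [← Nat.choose_symm_add] at hc
  push_cast at hc
  have hkj : ((k + j).factorial : ℝ) ≠ 0 := by positivity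
  have hk : (k.factorial : ℝ) ≠ 0 := by positivity
  have hj : (j.factorial : ℝ) ≠ 0 := by positivity
  rw [hsum, hb, genBessel_eq_alternatingSum ha]
  rw [← hc]
  have hch : ((k + j).choose k : ℝ) ≠ 0 := by
    have := (Nat.choose_pos (Nat.le_add_right k j)).ne'
    exact_mod_cast this
  field_simp

/-! ### The signless Bessel numbers -/

/-- Writing n = k + j avoids subtraction and matches the coefficient of q^j in the Bessel polynomial
y_n. -/
theorem genBessel_two_closed_form (n : ℕ) : genBessel 2 0 1 (1 : ℝ) 0 (n + 1) 0 = 0 ∧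
    ∀ k j : ℕ, k + j = n → genBessel 2 0 1 (1 : ℝ) 0 (n + 1) (k + 1) =
      ((k + 2 * j).factorial : ℝ) / (k.factorial * j.factorial * 2 ^ j) := by
  induction n with
  | zero =>
    refine ⟨by simp [genBessel], fun k j h => ?_⟩
    obtain ⟨rfl, rfl⟩ : k = 0 ∧ j = 0 := by omega
    simp [genBessel]
  | succ n ih =>
    obtain ⟨ih0, ih⟩ := ih
    refine ⟨by rw [genBessel, ih0]; simp, fun k j h => ?_⟩
    have hfac : ∀ i : ℕ, (i.factorial : ℝ) ≠ 0 := fun i => by positivity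
    rw [genBessel]
    rcases k with _ | k
    · obtain rfl : j = n + 1 := by omega
      rw [ih0, ih 0 n (by omega)]
      rw [show 0 + 2 * (n + 1) = 2 * n + 1 + 1 by ring, Nat.factorial_succ, Nat.factorial_succ,
        Nat.factorial_succ n]
      have := hfac n
      simp
      field_simp
      ring
    · rw [ih k j (by omega)]
      rcases j with _ | j
      · rw [genBessel_eq_zero_of_lt _ _ _ _ _ (n + 1) (k + 1 + 1) (by omega)]
        have := hfac k
        have := hfac (k + 1)
        simp
        field_simp
      · rw [ih (k + 1) j (by omega)]
        obtain rfl : n = k + j + 1 := by omega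
        rw [show k + 1 + 2 * (j + 1) = k + 2 * j + 1 + 1 + 1 by ring,
          show k + 2 * (j + 1) = k + 2 * j + 1 + 1 by ring, show k + 1 + 2 * j = k + 2 * j + 1 by ring]
        simp only [Nat.factorial_succ]
        have := hfac k
        have := hfac j
        push_cast
        simp
        field_simp
        ring

theorem besselPolynomial_coeff (n m : ℕ) : (besselPolynomial n).coeff m =
    if m ≤ n then ((n + m).factorial : ℝ) / ((n - m).factorial * m.factorial) / 2 ^ m else 0 := by
  rw [besselPolynomial, finsetSum_coeff]
  simp only [coeff_C_mul_X_pow]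
  rw [Finset.sum_ite_eq]
  simp

theorem genBessel_two_eq_signlessBessel (n k : ℕ) :
    genBessel 2 0 1 (1 : ℝ) 0 n k = signlessBessel n k := by
  rcases n with _ | n
  · cases k <;> simp [genBessel, signlessBessel]
  · rw [signlessBessel]
    split_ifs with h
    · rw [besselPolynomial_coeff]
      rcases k with _ | k
      · rw [(genBessel_two_closed_form n).1, if_neg (by omega)]
      · obtain ⟨j, rfl⟩ := Nat.exists_eq_add_of_le (show k ≤ n by omega)
        rw [(genBessel_two_closed_form (k + j)).2 k j rfl, show k + j + 1 - (k + 1) = j by omega,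
          if_pos (by omega), show k + j - j = k by omega, show k + j + j = k + 2 * j by ring, div_div]
    · rw [genBessel_eq_zero_of_lt]; omega

end Explicit

/-! ### The exponential generating function of the Stieltjes moment sequence -/

section GeneratingFunction

open Filter Topology

theorem genBessel_zero_lam_zero_succ (a : ℕ) (d c b : ℝ) (n : ℕ) :
    genBessel a d c b 0 (n + 1) 0 = (a * n + a * d) * b * genBessel a d c b 0 n 0 := by
  rw [genBessel]; simp

theorem factorial_mul_choose_succ (r : ℝ) (n : ℕ) :
    ((n + 1).factorial : ℝ) * Ring.choose r (n + 1) =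
      (r - n) * ((n.factorial : ℝ) * Ring.choose r n) := by
  have h : ∀ n : ℕ, (n.factorial : ℝ) * Ring.choose r n = (descPochhammer ℤ n).smeval r := fun n => by
    rw [Ring.descPochhammer_eq_factorial_smul_choose, nsmul_eq_mul]
  rw [h, h, descPochhammer_succ_right, Polynomial.smeval_mul]
  simp [Polynomial.smeval_sub, Polynomial.smeval_natCast]
  ring

/-- With ad = a - 1 and λ = 0 the zeroth column gains the factor (an + a - 1)b at each step, just as
the binomial coefficients of exponent 1/a do after scaling by -ab. -/
theorem choose_one_div_eq_genBessel {a : ℕ} (ha : 0 < a) (c : ℝ) {b : ℝ} (hb : 0 < b) (n : ℕ) :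
    -(c / b) * (((n + 1).factorial : ℝ) * Ring.choose (1 / (a : ℝ)) (n + 1)) *
      (-(a * b)) ^ (n + 1) = c * genBessel a ((a - 1) / a) c b 0 n 0 := by
  have ha' : (a : ℝ) ≠ 0 := by exact_mod_cast ha.ne'
  induction n with
  | zero =>
    simp [genBessel]
    field_simp
  | succ n ih =>
    rw [factorial_mul_choose_succ, genBessel_zero_lam_zero_succ, pow_succ]
    have e : (1 / (a : ℝ) - ((n + 1 : ℕ) : ℝ)) * (-(a * b)) =
        (a * n + a * ((a - 1) / a)) * b := by
      push_cast; field_simp; ring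
    linear_combination (a * n + a * ((a - 1) / a)) * b * ih + (-(c / b) *
      (((n + 1).factorial : ℝ) * Ring.choose (1 / (a : ℝ)) (n + 1)) * (-(a * b)) ^ (n + 1)) * e

theorem hasSum_generatingFunction {a : ℕ} (ha : 0 < a) (c : ℝ) {b : ℝ} (hb : 0 < b) :
    ∀ᶠ t : ℝ in 𝓝 0, HasSum (fun n : ℕ => c * genBessel a ((a - 1) / a) c b 0 n 0 *
      (t ^ (n + 1) / ((n + 1).factorial : ℝ))) (c / b * (1 - (1 - a * b * t) ^ (1 / (a : ℝ)))) := by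
  have hcont : Continuous fun t : ℝ => -(a * b * t) := by fun_prop
  have hev : ∀ᶠ t : ℝ in 𝓝 0, -(a * b * t) ∈ Metric.eball (0 : ℝ) 1 :=
    hcont.continuousAt.eventually_mem (Metric.isOpen_eball.mem_nhds (by simp))
  filter_upwards [hev] with t ht
  have h := (Real.one_add_rpow_hasFPowerSeriesOnBall_zero (a := 1 / (a : ℝ))).hasSum ht
  simp only [binomialSeries_apply, List.ofFn_const, List.prod_replicate, smul_eq_mul, zero_add] at h
  rw [← hasSum_nat_add_iff' 1] at h
  have h2 := h.mul_left (-(c / b))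
  convert! h2 using 1
  · funext n
    rw [← choose_one_div_eq_genBessel ha c hb, show -(a * b * t) = -(a * b) * t by ring, mul_pow]
    field_simp
  · simp
    ring_nf

end GeneratingFunction

theorem mainTheorem11 (a : ℕ) (ha : 0 < a) (d : ℝ) (had : ∃ p : ℕ, (a : ℝ) * d = p)
    (c : ℝ) (hc : 0 < c) :
    -- the signless Bessel numbers of the first kind as a special case
    (∀ n k : ℕ, genBessel 2 0 1 (1 : ℝ) 0 n k = signlessBessel n k) ∧
    -- (i) explicit formula; `descPochhammer` gives the falling factorial
    (∀ (b lam : ℝ) (n k : ℕ),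
      HasSum
        (fun j : ℕ => (a : ℝ) ^ n / (k.factorial : ℝ) *
          ∑ i ∈ Finset.range (k + j + 1),
            (-1 : ℝ) ^ ((n : ℤ) - (i : ℤ)) * b ^ ((n : ℤ) - (k : ℤ) - (j : ℤ)) * c ^ (k + j) *
              lam ^ j / (j.factorial : ℝ) * ((k + j).choose i : ℝ) *
              (descPochhammer ℝ n).eval (((i : ℝ) - a * d) / a))
        (genBessel a d c b lam n k)) ∧
    -- (ii) total positivity in the indeterminates `b = X 0`, `lam = X 1`
    CoeffTP (genBessel a d c (MvPolynomial.X 0 : MvPolynomial (Fin 2) ℝ) (MvPolynomial.X 1)) ∧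
    -- (iii) in the indeterminates `b = X 0`, `lam = X 1`, `q = X 2`
    ((a : ℝ) * d ≤ a - 1 →
      CoeffSM (genBesselRow a d c (MvPolynomial.X 0 : MvPolynomial (Fin 3) ℝ)
        (MvPolynomial.X 1) (MvPolynomial.X 2)) ∧
      CoeffLogConvex 3 (genBesselRow a d c (MvPolynomial.X 0 : MvPolynomial (Fin 3) ℝ)
        (MvPolynomial.X 1) (MvPolynomial.X 2)) ∧
      CoeffSM (fun n => genBessel a d c (MvPolynomial.X 0 : MvPolynomial (Fin 2) ℝ)
        (MvPolynomial.X 1) n 0) ∧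
      CoeffLogConvex 3 (fun n => genBessel a d c (MvPolynomial.X 0 : MvPolynomial (Fin 2) ℝ)
        (MvPolynomial.X 1) n 0)) ∧
    -- (iv) `f n` is indexed by `n ≥ 1`
    (∀ b : ℝ, 0 < b →
      ∃ f : ℕ → ℝ,
        (∀ᶠ t : ℝ in nhds 0,
          HasSum (fun n : ℕ => f (n + 1) * (t ^ (n + 1) / ((n + 1).factorial : ℝ)))
            (c / b * (1 - (1 - a * b * t) ^ (1 / (a : ℝ))))) ∧
        IsStieltjesMoment fun n => f (n + 1)) ∧
    -- (v) the convolution preserves the Stieltjes moment property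
    ((a : ℝ) * d ≤ a - 1 → ∀ b lam : ℝ, 0 ≤ b → 0 ≤ lam →
      ConvolutionPreservesSM (genBessel a d c b lam)) := by
  obtain ⟨p, hp⟩ := had
  have hle : (a : ℝ) * d ≤ a - 1 → p + 1 ≤ a := fun h => by
    have : (p : ℝ) + 1 ≤ a := by rw [← hp]; linarith
    exact_mod_cast this
  refine ⟨genBessel_two_eq_signlessBessel, fun b lam n k => genBessel_hasSum ha d c b lam n k,
    coeffTP_genBessel ha hp hc 0 1, fun h => ?_, fun b hb => ?_, fun _ b lam hb hlam =>
      convolutionPreservesSM_genBessel ha hp hc hb hlam⟩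
  · have h3 := coeffSM_genBessel ha hp (hle h) hc (X_mem_nonnegCoeffs (0 : Fin 3))
      (Subsemiring.add_mem _ (X_mem_nonnegCoeffs 1) (X_mem_nonnegCoeffs 2))
    have h2 := coeffSM_genBessel ha hp (hle h) hc (X_mem_nonnegCoeffs (0 : Fin 2))
      (X_mem_nonnegCoeffs 1)
    have hrow : genBesselRow a d c (MvPolynomial.X 0 : MvPolynomial (Fin 3) ℝ)
        (MvPolynomial.X 1) (MvPolynomial.X 2) = fun n => genBessel a d c (MvPolynomial.X 0)
        (MvPolynomial.X 1 + MvPolynomial.X 2) n 0 := funext fun n => genBesselRow_eq _ _ _ _ _ _ _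
    rw [hrow]
    exact ⟨h3.1, h3.2, h2.1, h2.2⟩
  -- Only indices n ≥ 1 count, so the truncated n - 1 at n = 0 does not matter. The d used here, (a
  -- - 1)/a, is independent of the given one.
  · refine ⟨fun n => c * genBessel a ((a - 1) / a) c b 0 (n - 1) 0,
      hasSum_generatingFunction ha c hb, IsMomentPositive.isStieltjesMoment ?_⟩
    have hd : (a : ℝ) * ((a - 1) / a) = ((a - 1 : ℕ) : ℝ) := by
      have : (a : ℝ) ≠ 0 := by exact_mod_cast ha.ne'
      rw [Nat.cast_pred ha]
      field_simp
    simpa using (isMomentPositive_genBessel ha hd hc hb.le le_rfl).scale zero_le_one hc.le
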